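/- Let $q$ be an odd prime power and $n\ge 0$. Let $\mathrm{U}(n,\mathbb{F}_q)$ be the group of invertible $n\times n$ matrices $g=(a_{ij})$ over $\mathbb{F}_{q^2}$ with $g=\big((a_{ji}^q)\big)^{-1}$. Let $C_{q+1}=\{x\in\mathbb{F}_{q^2}^\times : x^{q+1}=1\}$, identified with the group of scalar matrices in $\mathrm{U}(n,\mathbb{F}_q)$, and fix $\zeta\in C_{q+1}$ that is not a square in $C_{q+1}$. A conjugacy class of $\mathrm{U}(n,\mathbb{F}_q)$ is called real (respectively $\zeta$-real) if its elements $g$ are conjugate in $\mathrm{U}(n,\mathbb{F}_q)$ to $g^{-1}$ (respectively to $\zeta g^{-1}$). The conjugacy class of $g\in \mathrm{U}(n,\mathbb{F}_q)$ is parameterized by the following sequence $(f_1(t),f_2(t),\ldots)$ of monic polynomials over $\mathbb{F}_{q^2}$. The $\mathbb{F}_{q^2}[t]$-module $\mathbb{F}_{q^2}^n$ on which $t$ acts as $g$ is isomorphic to a finite direct sum $\bigoplus_j \mathbb{F}_{q^2}[t]/(P_j^{e_j})$ with $P_j$ monic irreducible and $e_j\ge 1$, and $f_i=\prod_{j:\,e_j=i}P_j$.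 The class is of type $\nu=(1^{m_1}2^{m_2}\cdots)$, a partition of $n$, if $\deg f_i=m_i$ for all $i\ge 1$. The group $C_{q+1}$ acts on polynomials by $\eta.f(t)=\eta^{\deg f}f(\eta^{-1}t)$ and on sequences termwise. Denote by $[(f_i)]$ the $C_{q+1}$-orbit of $(f_i)$; it is said to contain a conjugacy class of $\mathrm{U}(n,\mathbb{F}_q)$ if that class is parameterized by a sequence in $[(f_i)]$. Let $\mathcal{U}_q[t]$ be the set of monic $f\in\mathbb{F}_{q^2}[t]$ with $f(0)\ne 0$ and $f(t)=f(0)^{-q}t^{\deg f}f^{[q]}(t^{-1})$, where $f^{[q]}$ is obtained from $f$ by raising each coefficient to the power $q$. For $m\ge 1$ let $\mathcal{U}_q[t^m]=\{h(t^m): h\in\mathcal{U}_q[t]\}$. Let $|q+1|_2$ be the largest power of $2$ dividing $q+1$. Consider a conjugacy class of $\mathrm{U}(n,\mathbb{F}_q)$ of type $\nu=(1^{m_1}2^{m_2}\cdots)$ parameterized by $(f_1,f_2,\ldots)$. (i) If some $m_i$ is odd, then $[(f_i)]$ contains no $\zeta$-real classes, and contains either zero or exactly two real classes. (ii) If all $m_i$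 are even and $f_i\in\mathcal{U}_q[t^{|q+1|_2}]$ for all $i$, then $[(f_i)]$ contains either no real and no $\zeta$-real classes, or exactly one real class and exactly one $\zeta$-real class (these two may coincide). (iii) If all $m_i$ are even and $f_j\notin\mathcal{U}_q[t^{|q+1|_2}]$ for some $j$, then $[(f_i)]$ contains either no real and no $\zeta$-real classes, or exactly two real classes and no $\zeta$-real classes, or exactly two $\zeta$-real classes and no real classes. -/

import Mathlib

open Polynomial

/-- The `q`-power map `x ↦ x ^ q`, `q = p ^ k`, on a field of characteristic `p`. -/
noncomputable abbrev qFrob (p k : ℕ) [Fact p.Prime] (K : Type*) [Field K] [CharP K p] : K →+* K :=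
  iterateFrobenius K p k

/-- The cyclic group `C_{q+1} = {x ∈ Kˣ | x ^ (q+1) = 1}`, where `q = p ^ k`; this is `U(1, q)`, and
it is identified with the group of scalar matrices in `U(n, q)`. -/
abbrev CGroup (p k : ℕ) (K : Type*) [Field K] : Subgroup Kˣ := rootsOfUnity (p ^ k + 1) K

/-- The unitary group `U(n, q)`, `q = p ^ k`, inside `GL(n, K)` for a field `K` with `q ^ 2` elements:
the matrices `g = (a_ij)` with `(a_ji ^ q) * g = 1`, i.e. `g = (a_ji ^ q)⁻¹`. -/
def unitaryGrp (p k n : ℕ) [Fact p.Prime] (K : Type*) [Field K] [CharP K p] :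
    Subgroup (GL (Fin n) K) where
  carrier := {g | ((g : Matrix (Fin n) (Fin n) K).map (qFrob p k K)).transpose
    * (g : Matrix (Fin n) (Fin n) K) = 1}
  one_mem' := by simp
  mul_mem' := by
    intro a b ha hb
    simp only [Set.mem_ofPred_eq, Units.val_mul, Matrix.map_mul, Matrix.transpose_mul] at *
    rw [Matrix.mul_assoc, ← Matrix.mul_assoc _ a.val b.val, ha, Matrix.one_mul, hb]
  inv_mem' := by
    intro a ha
    simp only [Set.mem_ofPred_eq] at *
    have h1 : (a : Matrix (Fin n) (Fin n) K) * (a⁻¹ : GL (Fin n) K).val = 1 := a.mul_inv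
    have h2 := congrArg (fun M : Matrix (Fin n) (Fin n) K => (M.map (qFrob p k K)).transpose) h1
    simp only [Matrix.map_mul, Matrix.transpose_mul] at h2
    have h3 : (a.val.map (qFrob p k K)).transpose = (a⁻¹ : GL (Fin n) K).val := by
      calc (a.val.map (qFrob p k K)).transpose
          = (a.val.map (qFrob p k K)).transpose * (a.val * (a⁻¹ : GL (Fin n) K).val) := by
            rw [h1, mul_one]
        _ = (a⁻¹ : GL (Fin n) K).val := by rw [← mul_assoc, ha, one_mul]
    rw [h3] at h2
    rw [h2]
    simp

/-- The scalar matrix with diagonal entry `η ∈ C_{q+1}`, as an element of `U(n, q)`. -/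
def scalarU (p k n : ℕ) [Fact p.Prime] (K : Type*) [Field K] [CharP K p] (η : CGroup p k K) :
    unitaryGrp p k n K :=
  ⟨Units.map (Matrix.scalar (Fin n)).toMonoidHom η.1, by
    have h : (η.1 : K) ^ (p ^ k) * (η.1 : K) = 1 := by
      have := (mem_rootsOfUnity _ _).1 η.2
      rw [← pow_succ, ← Units.val_pow_eq_pow_val, this, Units.val_one]
    change ((Matrix.scalar (Fin n) (η.1 : K)).map (qFrob p k K)).transpose
      * (Matrix.scalar (Fin n) (η.1 : K)) = 1
    rw [Matrix.scalar_apply, Matrix.diagonal_map (map_zero _), Matrix.diagonal_transpose,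
      Matrix.diagonal_mul_diagonal, iterateFrobenius_def, h, Matrix.diagonal_one]⟩

/-- A conjugacy class of `U(n, q)` is real if each of its elements is conjugate in `U(n, q)` to its
inverse. -/
def IsRealClass {p k n : ℕ} [Fact p.Prime] {K : Type*} [Field K] [CharP K p]
    (c : ConjClasses (unitaryGrp p k n K)) : Prop :=
  ∀ g, ConjClasses.mk g = c → IsConj g g⁻¹

/-- A conjugacy class of `U(n, q)` is `ζ`-real if each of its elements `g` is conjugate in `U(n, q)`
to `ζ g⁻¹`. -/
def IsZetaRealClass {p k n : ℕ} [Fact p.Prime] {K : Type*} [Field K] [CharP K p]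
    (ζ : CGroup p k K) (c : ConjClasses (unitaryGrp p k n K)) : Prop :=
  ∀ g, ConjClasses.mk g = c → IsConj g (scalarU p k n K ζ * g⁻¹)

/-- The sequence `(f_1, f_2, …)` attached to an invertible matrix `g`: if the `K[t]`-module `K^n` on
which `t` acts as `g` is isomorphic to the (finite) direct sum of the cyclic modules
`K[t] / (P_j ^ e_j)` with `P_j` monic irreducible and `e_j ≥ 1`, then `f_i` is the product of all
`P_j` with `e_j = i`. In particular the characteristic polynomial of `g` is `∏ f_i ^ i`. -/
def HasSequence {n : ℕ} {K : Type*} [Field K] (g : GL (Fin n) K) (f : ℕ+ → K[X]) : Prop :=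
  ∃ (r : ℕ) (P : Fin r → K[X]) (e : Fin r → ℕ+),
    (∀ j, (P j).Monic ∧ Irreducible (P j)) ∧
    Nonempty (Module.AEval' (Matrix.toLin' (g : Matrix (Fin n) (Fin n) K)) ≃ₗ[K[X]]
      ((j : Fin r) → K[X] ⧸ Ideal.span {P j ^ (e j : ℕ)})) ∧
    ∀ i, f i = ∏ j with e j = i, P j

/-- The conjugacy class `c` of `U(n, q)` is the one parameterized by `(f_1, f_2, …)`. -/
def IsParameterizedBy {p k n : ℕ} [Fact p.Prime] {K : Type*} [Field K] [CharP K p]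
    (c : ConjClasses (unitaryGrp p k n K)) (f : ℕ+ → K[X]) : Prop :=
  ∀ g, ConjClasses.mk g = c → HasSequence (g : GL (Fin n) K) f

/-- The `∼`-conjugate polynomial `f(0)^{-q} t^d f^{[q]}(t⁻¹)`, where `d = deg f`, `q = p ^ k`, and
`f^{[q]}` is `f` with the `q`-power map applied to its coefficients. -/
noncomputable def conjPoly (p k : ℕ) [Fact p.Prime] {K : Type*} [Field K] [CharP K p] (f : K[X]) :
    K[X] :=
  C ((f.coeff 0 ^ (p ^ k))⁻¹) * (f.map (qFrob p k K)).reverse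

/-- The set `𝒰_q[t]` of self-conjugate monic polynomials with nonzero constant term. -/
def UPoly (p k : ℕ) [Fact p.Prime] (K : Type*) [Field K] [CharP K p] : Set K[X] :=
  {f | f.Monic ∧ f.coeff 0 ≠ 0 ∧ f = conjPoly p k f}

/-- The set `𝒰_q[t^m]` of the polynomials `h(t^m)` with `h ∈ 𝒰_q[t]`. -/
def UPolyPow (p k : ℕ) [Fact p.Prime] (K : Type*) [Field K] [CharP K p] (m : ℕ) : Set K[X] :=
  {f | ∃ h ∈ UPoly p k K, f = expand K m h}

/-- The `2`-part `|m|_2`, the largest power of `2` dividing `m` (for `m > 0`). -/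
def twoPart (m : ℕ) : ℕ := 2 ^ padicValNat 2 m

/-- The `C_{q+1}`-orbit `[(f_i)]` of a sequence of polynomials under the action
`(η.f)(t) = η ^ (deg f) * f(t η⁻¹)` applied to each term; `f.scaleRoots η` has the coefficients
`η ^ (deg f - j) * a_j`, where `a_j` are those of `f`. -/
def seqOrbit (p k : ℕ) {K : Type*} [Field K] (f : ℕ+ → K[X]) : Set (ℕ+ → K[X]) :=
  {f' | ∃ η : CGroup p k K, ∀ i, f' i = (f i).scaleRoots ((η : Kˣ) : K)}

/-- The conjugacy classes of `U(n, q)` contained in the orbit `[(f_i)]`, i.e. those parameterized by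
a sequence in the orbit. -/
def orbitClasses (p k n : ℕ) [Fact p.Prime] {K : Type*} [Field K] [CharP K p] (f : ℕ+ → K[X]) :
    Set (ConjClasses (unitaryGrp p k n K)) :=
  {c | ∃ f' ∈ seqOrbit p k f, IsParameterizedBy c f'}

/-- The number of real classes of `U(n, q)` contained in the orbit `[(f_i)]`. -/
noncomputable def numReal (p k n : ℕ) [Fact p.Prime] {K : Type*} [Field K] [CharP K p]
    (f : ℕ+ → K[X]) : ℕ∞ :=
  {c ∈ orbitClasses p k n f | IsRealClass c}.encard

/-- The number of `ζ`-real classes of `U(n, q)` contained in the orbit `[(f_i)]`. -/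
noncomputable def numZetaReal (p k n : ℕ) [Fact p.Prime] {K : Type*} [Field K] [CharP K p]
    (ζ : CGroup p k K) (f : ℕ+ → K[X]) : ℕ∞ :=
  {c ∈ orbitClasses p k n f | IsZetaRealClass ζ c}.encard

/-!
A matrix `g` is determined up to similarity by its sequence `f = (f_1, f_2, …)`: the multiplicity of
an irreducible `Q` in `f_i` is a second difference of the dimensions of the kernels of `Q(g) ^ i`
(`HasSequence.exists_emultiplicity`). Comparing these dimensions for two matrices shows that `η g`
has the sequence `η.f`, that `g⁻¹` has the sequence of the reciprocals of the `f_i`, and that the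
conjugate transpose of `g` has the sequence `f^[q]` (`HasSequence.scaleRoots`, `HasSequence.inv`,
`HasSequence.map_transpose`). For unitary `g` the last two agree, so the `f_i` are self-conjugate.

Unitary matrices that are similar are conjugate in `U(n, q)` (`isConj_of_conj_in_GL`). This comes
down to writing an invertible hermitian matrix `s` as `y* y` with `y` commuting with the centralizer
of `s`. With `δ^q = -δ` and hermitian `a`, `b` in the commutative ring generated by `s` and `δ ^ 2`,
the element `y = a + δ b` has `y* y = a ^ 2 - δ ^ 2 b ^ 2`, and over a finite commutative ring of odd
characteristic this form represents every unit: over the residue fields by a pigeonhole argument,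
and then modulo nilpotents because `1 + x` with `x` nilpotent is a square (`exists_sq_sub_mul_sq_eq`).

Hence the classes in the orbit of `f` correspond to the quotient of `C_{q+1}` by the stabilizer `H`
of `f`, and the class of `η.f` is `t`-real (`t = 1` for real, `t = ζ` for `ζ`-real) if and only if
`η.f = t.(η.f)^[q]`. If no `s` satisfies `f^[q] = s.f`, there are no such classes; otherwise they
correspond to the square roots of `t s` in `C_{q+1} / H` (`numZetaReal_eq_encard`). If `C_{q+1} / H`
has odd order, there is exactly one for each `t`. If the order is even, exactly one of `s` and `ζ s`
is a square there, and it has two square roots (`encard_sq_eq_of_even_card`). The order is odd if and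
only if `H` contains the elements of order `|q+1|_2`, which means that all `f_i` are polynomials in
`t ^ |q+1|_2` (`odd_card_quotient_seqStabilizer_iff`). If some `f_i` has odd degree, then the order
is even, and comparing the constant terms in `f^[q] = s.f` shows that `s` itself is a square, so the
two classes are real (`isSquare_of_odd_natDegree`).
-/

/-! ### Kernels of polynomials on cyclic modules -/

/-- On `K[t] / (b)` the kernel of multiplication by `a` has dimension `deg gcd(a, b)`: it has the
dimension of the cokernel `K[t] / (a, b)`. -/
theorem finrank_torsionBy_quotient {K : Type*} [Field K] {a b d : K[X]} (hb : b ≠ 0)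
    (hd : Ideal.span {d} = Ideal.span {a} ⊔ Ideal.span {b}) :
    Module.finrank K (Submodule.torsionBy K[X] (K[X] ⧸ Ideal.span {b}) a) = d.natDegree := by
  have : Module.Finite K (K[X] ⧸ Ideal.span {b}) := by
    have := (AdjoinRoot.powerBasis hb).finite
    exact this
  let M := K[X] ⧸ Ideal.span {b}
  let φ : M →ₗ[K[X]] M := LinearMap.lsmul K[X] M a
  let ψ : M →ₗ[K] M := φ.restrictScalars K
  have h1 := LinearMap.finrank_range_add_finrank_ker ψ
  have h2 := Submodule.finrank_quotient_add_finrank (LinearMap.range ψ)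
  have h3 : Module.finrank K (M ⧸ LinearMap.range ψ) = d.natDegree := by
    rw [← finrank_quotient_span_eq_natDegree (f := d)]
    let π : K[X] →ₗ[K[X]] M ⧸ LinearMap.range φ :=
      (LinearMap.range φ).mkQ ∘ₗ (Submodule.mkQ (Ideal.span {b}))
    have hker : LinearMap.ker π = Ideal.span {d} := by
      rw [hd]
      ext x
      simp only [π, LinearMap.mem_ker, LinearMap.comp_apply, Submodule.mkQ_apply]
      rw [Submodule.Quotient.mk_eq_zero, LinearMap.mem_range, Submodule.mem_sup]
      constructor
      · rintro ⟨y, hy⟩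
        obtain ⟨y, rfl⟩ := Submodule.Quotient.mk_surjective _ y
        refine ⟨a * y, Ideal.mul_mem_right _ _ (Ideal.mem_span_singleton_self a), x - a * y, ?_,
          by ring⟩
        rw [← Submodule.neg_mem_iff, neg_sub]
        exact (Submodule.Quotient.eq _).1 hy
      · rintro ⟨u, hu, v, hv, rfl⟩
        obtain ⟨y, rfl⟩ := Ideal.mem_span_singleton.1 hu
        refine ⟨Submodule.Quotient.mk y, ?_⟩
        refine (Submodule.Quotient.eq _).2 ?_
        rw [← Submodule.neg_mem_iff]
        simpa using hv
    have hsurj : Function.Surjective π :=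
      (Submodule.mkQ_surjective _).comp (Submodule.mkQ_surjective _)
    have e := (Submodule.quotEquivOfEq _ _ hker.symm).trans (π.quotKerEquivOfSurjective hsurj)
    exact (e.restrictScalars K).finrank_eq.symm
  have h4 : Module.finrank K (LinearMap.ker ψ) =
      Module.finrank K (Submodule.torsionBy K[X] M a) := rfl
  change Module.finrank K (Submodule.torsionBy K[X] M a) = _
  omega

theorem finrank_torsionBy_pi {K : Type*} [Field K] {ι : Type*} [Fintype ι] (M : ι → Type*)
    [∀ i, AddCommGroup (M i)] [∀ i, Module K (M i)] [∀ i, Module K[X] (M i)]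
    [∀ i, IsScalarTower K K[X] (M i)] [∀ i, Module.Finite K (M i)] (a : K[X]) :
    Module.finrank K (Submodule.torsionBy K[X] (∀ i, M i) a) =
      ∑ i, Module.finrank K (Submodule.torsionBy K[X] (M i) a) := by
  have : ∀ i, Module.Finite K (Submodule.torsionBy K[X] (M i) a) := fun i =>
    Module.Finite.of_injective ((Submodule.torsionBy K[X] (M i) a).subtype.restrictScalars K)
      Subtype.val_injective
  rw [← Module.finrank_pi_fintype K]
  refine LinearEquiv.finrank_eq
    { toFun := fun x i => ⟨x.1 i, congrFun x.2 i⟩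
      invFun := fun x => ⟨fun i => (x i).1, funext fun i => (x i).2⟩
      map_add' := fun _ _ => rfl
      map_smul' := fun _ _ => rfl
      left_inv := fun _ => rfl
      right_inv := fun _ => rfl }

theorem LinearEquiv.finrank_torsionBy_eq {K : Type*} [Field K] {M N : Type*} [AddCommGroup M]
    [AddCommGroup N] [Module K M] [Module K N] [Module K[X] M] [Module K[X] N]
    [IsScalarTower K K[X] M] [IsScalarTower K K[X] N] (e : M ≃ₗ[K[X]] N) (a : K[X]) :
    Module.finrank K (Submodule.torsionBy K[X] M a) =
      Module.finrank K (Submodule.torsionBy K[X] N a) := by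
  refine LinearEquiv.finrank_eq
    { toFun := fun x => ⟨e x.1, by
        have := x.2
        rw [Submodule.mem_torsionBy_iff] at this ⊢
        rw [← map_smul, this, map_zero]⟩
      invFun := fun x => ⟨e.symm x.1, by
        have := x.2
        rw [Submodule.mem_torsionBy_iff] at this ⊢
        rw [← map_smul, this, map_zero]⟩
      map_add' := fun _ _ => Subtype.ext (map_add e _ _)
      map_smul' := fun c x => Subtype.ext ((e.restrictScalars K).map_smul c x.1)
      left_inv := fun _ => Subtype.ext (e.symm_apply_apply _)
      right_inv := fun _ => Subtype.ext (e.apply_symm_apply _) }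

/-- On the cyclic module `K[t] / (P ^ e)` the kernel of `Q ^ i` has dimension `min i e * deg Q` if
`P = Q`, and is trivial if the irreducible polynomials `P` and `Q` are different. -/
theorem finrank_torsionBy_pow_quotient {K : Type*} [Field K] {P Q : K[X]} (hPm : P.Monic)
    (hP : Irreducible P) (hQm : Q.Monic) (hQ : Irreducible Q) (i e : ℕ) [Decidable (P = Q)] :
    Module.finrank K (Submodule.torsionBy K[X] (K[X] ⧸ Ideal.span {P ^ e}) (Q ^ i)) =
      if P = Q then min i e * Q.natDegree else 0 := by
  split_ifs with h
  · subst h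
    rw [finrank_torsionBy_quotient (d := P ^ min i e) (pow_ne_zero _ hP.ne_zero),
      natDegree_pow]
    rcases le_total i e with h | h
    · rw [min_eq_left h, left_eq_sup, Ideal.span_singleton_le_span_singleton]
      exact pow_dvd_pow _ h
    · rw [min_eq_right h, right_eq_sup, Ideal.span_singleton_le_span_singleton]
      exact pow_dvd_pow _ h
  · rw [finrank_torsionBy_quotient (d := 1) (pow_ne_zero _ hP.ne_zero), natDegree_one]
    rw [Ideal.span_singleton_one, eq_comm, ← Ideal.isCoprime_iff_sup_eq,
      Ideal.isCoprime_span_singleton_iff]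
    refine IsCoprime.pow ((hQ.coprime_iff_not_dvd).2 fun hd => h ?_)
    exact eq_of_monic_of_associated hPm hQm
      ((hQ.associated_of_dvd hP hd).symm)

/-! ### Similarity of matrices and sequences of polynomials -/

/-- The dimension of the kernel of `Q(g)`. -/
noncomputable def nullity {n : ℕ} {K : Type*} [Field K] (g : GL (Fin n) K) (Q : K[X]) : ℕ :=
  Module.finrank K (Submodule.torsionBy K[X]
    (Module.AEval' (Matrix.toLin' (g : Matrix (Fin n) (Fin n) K))) Q)

theorem nullity_add_rank {n : ℕ} {K : Type*} [Field K] (g : GL (Fin n) K) (Q : K[X]) :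
    nullity g Q + (aeval (g : Matrix (Fin n) (Fin n) K) Q).rank = n := by
  have h1 := LinearMap.finrank_range_add_finrank_ker
    (Matrix.toLin' (aeval (g : Matrix (Fin n) (Fin n) K) Q))
  rw [Module.finrank_fin_fun] at h1
  have h2 : nullity g Q = Module.finrank K (LinearMap.ker
      (Matrix.toLin' (aeval (g : Matrix (Fin n) (Fin n) K) Q))) := by
    have h3 : Matrix.toLin' (aeval (g : Matrix (Fin n) (Fin n) K) Q) =
        aeval (Matrix.toLin' (g : Matrix (Fin n) (Fin n) K)) Q :=
      (aeval_algHom_apply (Matrix.toLinAlgEquiv' : _ ≃ₐ[K] _)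
        (g : Matrix (Fin n) (Fin n) K) Q).symm
    rw [h3]
    rfl
  rw [h2, Matrix.rank, ← Matrix.toLin'_apply', add_comm]
  exact h1

open Classical in
theorem emultiplicity_prod_monic {K : Type*} [Field K] {r : ℕ} {P : Fin r → K[X]}
    {e : Fin r → ℕ+} (hP : ∀ j, (P j).Monic ∧ Irreducible (P j)) {Q : K[X]} (hQm : Q.Monic)
    (hQ : Irreducible Q) (i : ℕ+) :
    emultiplicity Q (∏ j with e j = i, P j) = Fintype.card {j // (P j, e j) = (Q, i)} := by
  rw [Finset.emultiplicity_prod hQ.prime, Fintype.card_subtype]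
  have h : ∀ j, emultiplicity Q (P j) = if P j = Q then 1 else 0 := by
    intro j
    split_ifs with h
    · rw [h]
      exact (FiniteMultiplicity.of_not_isUnit hQ.not_isUnit hQ.ne_zero).emultiplicity_self
    · rw [emultiplicity_eq_zero]
      exact fun hd => h (eq_of_monic_of_associated (hP j).1 hQm
        ((hQ.associated_of_dvd (hP j).2 hd).symm))
  simp_rw [h]
  rw [Finset.sum_boole, Finset.filter_filter]
  simp only [Prod.mk.injEq, and_comm]

theorem HasSequence.monic {n : ℕ} {K : Type*} [Field K] {g : GL (Fin n) K} {f : ℕ+ → K[X]}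
    (h : HasSequence g f) (i : ℕ+) : (f i).Monic := by
  obtain ⟨r, P, e, hP, -, hf⟩ := h
  rw [hf]
  exact monic_prod_of_monic _ _ fun j _ => (hP j).1

/-- The multiplicity `m` of an irreducible polynomial `Q` in `f_i` is determined by the dimensions
of the kernels of the powers of `Q(g)`. -/
theorem HasSequence.exists_emultiplicity {n : ℕ} {K : Type*} [Field K] {g : GL (Fin n) K}
    {f : ℕ+ → K[X]} (h : HasSequence g f) {Q : K[X]} (hQm : Q.Monic) (hQ : Irreducible Q)
    (i : ℕ+) : ∃ m : ℕ, emultiplicity Q (f i) = m ∧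
      2 * nullity g (Q ^ (i : ℕ)) =
        nullity g (Q ^ ((i : ℕ) - 1)) + nullity g (Q ^ ((i : ℕ) + 1)) + m * Q.natDegree := by
  classical
  obtain ⟨r, P, e, hP, ⟨φ⟩, hf⟩ := h
  refine ⟨_, by rw [hf]; exact emultiplicity_prod_monic hP hQm hQ i, ?_⟩
  have : ∀ j, Module.Finite K (K[X] ⧸ Ideal.span {P j ^ (e j : ℕ)}) := fun j =>
    (AdjoinRoot.powerBasis (pow_ne_zero _ (hP j).2.ne_zero)).finite
  have hN : ∀ k, nullity g (Q ^ k) = ∑ j, if P j = Q then min k (e j : ℕ) * Q.natDegree else 0 := by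
    intro k
    rw [nullity, φ.finrank_torsionBy_eq, finrank_torsionBy_pi]
    exact Finset.sum_congr rfl fun j _ =>
      finrank_torsionBy_pow_quotient (hP j).1 (hP j).2 hQm hQ _ _
  rw [hN, hN, hN, Fintype.card_subtype, Finset.card_filter, Finset.sum_mul, Finset.mul_sum,
    ← Finset.sum_add_distrib, ← Finset.sum_add_distrib]
  refine Finset.sum_congr rfl fun j _ => ?_
  have hi := i.pos
  simp only [Prod.mk.injEq]
  by_cases h1 : P j = Q
  · simp only [h1, if_true, true_and]
    rw [← add_mul, ← add_mul, ← mul_assoc]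
    congr 1
    split_ifs with h2
    · rw [h2]; omega
    · have : (e j : ℕ) ≠ i := fun h => h2 (PNat.coe_inj.1 h)
      omega
  · simp [h1]

/-- If the kernels of the powers of `Q'(g)` and of `Q(h)` have the same dimensions, then `Q'`
occurs in the sequence of `g` as often as `Q` does in that of `h`. -/
theorem HasSequence.emultiplicity_eq {n : ℕ} {K : Type*} [Field K] {g h : GL (Fin n) K}
    {f f' : ℕ+ → K[X]} (hf : HasSequence g f) (hf' : HasSequence h f') {Q Q' : K[X]}
    (hQm : Q.Monic) (hQ : Irreducible Q) (hQm' : Q'.Monic) (hQ' : Irreducible Q')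
    (hdeg : Q'.natDegree = Q.natDegree) (hN : ∀ k, nullity h (Q ^ k) = nullity g (Q' ^ k))
    (i : ℕ+) : emultiplicity Q (f' i) = emultiplicity Q' (f i) := by
  obtain ⟨m, hm, h1⟩ := hf.exists_emultiplicity hQm' hQ' i
  obtain ⟨m', hm', h2⟩ := hf'.exists_emultiplicity hQm hQ i
  rw [hm, hm']
  rw [hN, hN, hN, h1, hdeg] at h2
  have := Nat.eq_of_mul_eq_mul_right hQ.natDegree_pos (Nat.add_left_cancel h2)
  rw [this]

theorem Polynomial.Monic.eq_of_emultiplicity_eq {K : Type*} [Field K] {f g : K[X]} (hf : f.Monic)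
    (hg : g.Monic)
    (h : ∀ Q : K[X], Q.Monic → Irreducible Q → emultiplicity Q f = emultiplicity Q g) :
    f = g := by
  classical
  have h' : ∀ Q : K[X], Irreducible Q → emultiplicity Q f = emultiplicity Q g := by
    intro Q hQ
    have ha : Associated (normalize Q) Q := normalize_associated Q
    have h1 := h (normalize Q) (monic_normalize hQ.ne_zero) (ha.symm.irreducible hQ)
    rwa [emultiplicity_eq_of_associated_left ha.symm,
      emultiplicity_eq_of_associated_left ha.symm] at h1
  refine eq_of_monic_of_associated hf hg (associated_of_dvd_dvd ?_ ?_)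
  · rw [UniqueFactorizationMonoid.dvd_iff_emultiplicity_le hf.ne_zero]
    intro p hp
    exact (h' p hp.irreducible).le
  · rw [UniqueFactorizationMonoid.dvd_iff_emultiplicity_le hg.ne_zero]
    intro p hp
    exact (h' p hp.irreducible).ge

theorem HasSequence.unique {n : ℕ} {K : Type*} [Field K] {g : GL (Fin n) K} {f f' : ℕ+ → K[X]}
    (hf : HasSequence g f) (hf' : HasSequence g f') : f = f' :=
  funext fun i => (hf.monic i).eq_of_emultiplicity_eq (hf'.monic i) fun _ hQm hQ =>
    hf'.emultiplicity_eq hf hQm hQ hQm hQ rfl (fun _ => rfl) i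

/-- Matrices with the same sequence are similar: in both decompositions into cyclic modules each
pair `(Q, i)` occurs equally often, so the summands can be matched. -/
theorem HasSequence.exists_conj {n : ℕ} {K : Type*} [Field K] {g h : GL (Fin n) K}
    {f : ℕ+ → K[X]} (hg : HasSequence g f) (hh : HasSequence h f) :
    ∃ x : GL (Fin n) K, x * g = h * x := by
  classical
  obtain ⟨r, P, e, hP, ⟨φ⟩, hf⟩ := hg
  obtain ⟨r', P', e', hP', ⟨φ'⟩, hf'⟩ := hh
  have hcard : ∀ c : K[X] × ℕ+,
      Fintype.card {j // (P j, e j) = c} = Fintype.card {j // (P' j, e' j) = c} := by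
    rintro ⟨Q, i⟩
    by_cases hQ : Q.Monic ∧ Irreducible Q
    · have h1 := emultiplicity_prod_monic (e := e) hP hQ.1 hQ.2 i
      have h2 := emultiplicity_prod_monic (e := e') hP' hQ.1 hQ.2 i
      rw [← hf] at h1
      rw [← hf', h1] at h2
      exact_mod_cast h2
    · rw [Fintype.card_eq_zero_iff.2, Fintype.card_eq_zero_iff.2]
      · exact ⟨fun ⟨j, hj⟩ => hQ (by rw [Prod.mk.injEq] at hj; rw [← hj.1]; exact hP' j)⟩
      · exact ⟨fun ⟨j, hj⟩ => hQ (by rw [Prod.mk.injEq] at hj; rw [← hj.1]; exact hP j)⟩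
  obtain ⟨σ, hσ⟩ : ∃ σ : Fin r ≃ Fin r', ∀ j, (P' (σ j), e' (σ j)) = (P j, e j) :=
    ⟨Equiv.ofFiberEquiv fun c => Fintype.equivOfCardEq (hcard c),
      fun j => Equiv.ofFiberEquiv_map (f := fun j => (P j, e j)) (g := fun j => (P' j, e' j)) _ j⟩
  have hσP : P = fun j => P' (σ j) := funext fun j => (congrArg Prod.fst (hσ j)).symm
  have hσe : e = fun j => e' (σ j) := funext fun j => (congrArg Prod.snd (hσ j)).symm
  subst hσP hσe
  let ψ := LinearEquiv.piCongrLeft K[X]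
    (fun j : Fin r' => K[X] ⧸ Ideal.span {P' j ^ (e' j : ℕ)}) σ
  let Φ := (φ.trans ψ).trans φ'.symm
  let A := Matrix.toLin' (g : Matrix (Fin n) (Fin n) K)
  let B := Matrix.toLin' (h : Matrix (Fin n) (Fin n) K)
  let T : (Fin n → K) ≃ₗ[K] (Fin n → K) :=
    ((Module.AEval'.of A).trans (Φ.restrictScalars K)).trans (Module.AEval'.of B).symm
  have hT : ∀ v, T (A v) = B (T v) := by
    intro v
    have h1 : Module.AEval'.of A (A v) = (X : K[X]) • Module.AEval'.of A v :=
      (Module.AEval'.X_smul_of A v).symm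
    change (Module.AEval'.of B).symm (Φ (Module.AEval'.of A (A v))) =
      B ((Module.AEval'.of B).symm (Φ (Module.AEval'.of A v)))
    rw [h1, map_smul]
    exact Module.AEval.of_symm_X_smul _ _
  refine ⟨(Matrix.GeneralLinearGroup.toLin).symm
    ((LinearMap.GeneralLinearGroup.generalLinearEquiv K _).symm T), ?_⟩
  apply (Matrix.GeneralLinearGroup.toLin).injective
  rw [map_mul, map_mul, MulEquiv.apply_symm_apply]
  ext1
  exact LinearMap.ext hT

theorem hasSequence_congr {n : ℕ} {K : Type*} [Field K] {g h x : GL (Fin n) K} {f : ℕ+ → K[X]}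
    (hx : x * g = h * x) (hg : HasSequence g f) : HasSequence h f := by
  obtain ⟨r, P, e, hP, ⟨φ⟩, hf⟩ := hg
  let T := (LinearMap.GeneralLinearGroup.generalLinearEquiv K _)
    (Matrix.GeneralLinearGroup.toLin x⁻¹)
  refine ⟨r, P, e, hP, ⟨(LinearEquiv.ofAEval (Matrix.toLin' (h : Matrix (Fin n) (Fin n) K))
    (T.trans (Module.AEval'.of _)) fun v => ?_).trans φ⟩, hf⟩
  have h1 : x⁻¹ * h = g * x⁻¹ := by rw [inv_mul_eq_iff_eq_mul, ← mul_assoc, hx, mul_assoc,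
    mul_inv_cancel, mul_one]
  have h2 := congrArg (fun y : GL (Fin n) K => Matrix.toLin' y.val v) h1
  simp only [Units.val_mul, Matrix.toLin'_mul] at h2
  change Module.AEval'.of _ (Matrix.toLin' (x⁻¹ : GL (Fin n) K).1 (Matrix.toLin' h.1 v)) =
    (X : K[X]) • Module.AEval'.of _ (Matrix.toLin' (x⁻¹ : GL (Fin n) K).1 v)
  rw [Module.AEval'.X_smul_of]
  exact congrArg _ h2

/-- Every invertible matrix has a sequence. The structure theorem over the principal ideal domain
`K[t]` may produce zero exponents and polynomials that are not monic, so the trivial summands are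
dropped and the polynomials are normalized. -/
theorem exists_hasSequence {n : ℕ} {K : Type*} [Field K] (g : GL (Fin n) K) :
    ∃ f, HasSequence g f := by
  classical
  let A := Matrix.toLin' (g : Matrix (Fin n) (Fin n) K)
  have htors : Module.IsTorsion K[X] (Module.AEval' A) := by
    intro x
    refine ⟨⟨g.1.charpoly, mem_nonZeroDivisors_of_ne_zero (Matrix.charpoly_monic _).ne_zero⟩, ?_⟩
    apply (Module.AEval'.of A).symm.injective
    have h3 : Matrix.toLin' (aeval (g : Matrix (Fin n) (Fin n) K) g.1.charpoly) =
        aeval (Matrix.toLin' (g : Matrix (Fin n) (Fin n) K)) g.1.charpoly :=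
      (aeval_algHom_apply (Matrix.toLinAlgEquiv' : _ ≃ₐ[K] _)
        (g : Matrix (Fin n) (Fin n) K) _).symm
    rw [Matrix.aeval_self_charpoly, map_zero] at h3
    change aeval A g.1.charpoly _ = _
    rw [← h3]
    rfl
  obtain ⟨ι, _, p, hp, e, ⟨φ⟩⟩ := Module.equiv_directSum_of_isTorsion htors
  let ι' := {i : ι // e i ≠ 0}
  let ε := (Fintype.equivFin ι').symm
  refine ⟨_, Fintype.card ι', fun j => normalize (p (ε j).1),
    fun j => ⟨e (ε j).1, Nat.pos_of_ne_zero (ε j).2⟩, fun j => ⟨monic_normalize (hp _).ne_zero,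
      (normalize_associated _).symm.irreducible (hp _)⟩, ⟨?_⟩, fun i => rfl⟩
  let φ1 := φ.trans (DirectSum.linearEquivFunOnFintype K[X] ι
    (fun i => K[X] ⧸ Submodule.span K[X] {p i ^ e i}))
  have hzero : ∀ i, e i = 0 → Subsingleton (K[X] ⧸ Submodule.span K[X] {p i ^ e i}) := by
    intro i hi
    rw [Submodule.Quotient.subsingleton_iff, hi, pow_zero]
    exact Ideal.span_singleton_one
  let φ2 : (∀ i, K[X] ⧸ Submodule.span K[X] {p i ^ e i}) ≃ₗ[K[X]]
      (∀ i : ι', K[X] ⧸ Submodule.span K[X] {p i.1 ^ e i.1}) :=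
    { toFun := fun x i => x i.1
      invFun := fun x i => if h : e i ≠ 0 then x ⟨i, h⟩ else 0
      map_add' := fun _ _ => rfl
      map_smul' := fun _ _ => rfl
      left_inv := fun x => funext fun i => by
        by_cases h : e i = 0
        · have := hzero i h
          exact Subsingleton.elim _ _
        · simp [h]
      right_inv := fun x => funext fun i => by
        exact dif_pos i.2 }
  let φ3 := (LinearEquiv.piCongrLeft K[X]
    (fun i : ι' => K[X] ⧸ Submodule.span K[X] {p i.1 ^ e i.1}) ε).symm
  let φ4 : (∀ j, K[X] ⧸ Submodule.span K[X] {p (ε j).1 ^ e (ε j).1}) ≃ₗ[K[X]]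
      (∀ j, K[X] ⧸ Ideal.span {normalize (p (ε j).1) ^ e (ε j).1}) :=
    LinearEquiv.piCongrRight fun j => Submodule.quotEquivOfEq _ _
      (Ideal.span_singleton_eq_span_singleton.2
        ((normalize_associated (p (ε j).1)).symm.pow_pow))
  exact ((φ1.trans φ2).trans φ3).trans φ4

/-! ### Operations on matrices and their effect on the sequence -/

/-- Field homomorphisms preserve the rank, since they preserve the rank normal form. -/
theorem Matrix.rank_map_of_field {n : ℕ} {K L : Type*} [Field K] [Field L] (σ : K →+* L)
    (A : Matrix (Fin n) (Fin n) K) : (A.map σ).rank = A.rank := by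
  obtain ⟨V, U, e, hV, hU, h⟩ := A.exists_rank_normal_form
  have h1 : V.map σ * A.map σ * U.map σ =
      (Matrix.fromBlocks (1 : Matrix (Fin A.rank) (Fin A.rank) L) 0 0
        (0 : Matrix (Fin (Fintype.card (Fin n) - A.rank)) _ L)).submatrix e e := by
    rw [← Matrix.map_mul, ← Matrix.map_mul, h, ← Matrix.submatrix_map, Matrix.fromBlocks_map]
    simp
  have hunit : ∀ M : Matrix (Fin n) (Fin n) K, IsUnit M → IsUnit (M.map σ).det := by
    intro M hM
    have := (hM.map σ.mapMatrix)
    exact (Matrix.isUnit_iff_isUnit_det _).1 this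
  rw [← Matrix.rank_mul_eq_right_of_isUnit_det _ _ (hunit V hV),
    ← Matrix.rank_mul_eq_left_of_isUnit_det _ _ (hunit U hU), h1, Matrix.rank_submatrix,
    ← Matrix.diagonal_one, ← Matrix.diagonal_zero, Matrix.fromBlocks_diagonal]
  classical
  rw [Matrix.rank_diagonal, ← Nat.card_eq_fintype_card]
  have : {i : Fin A.rank ⊕ Fin (Fintype.card (Fin n) - A.rank) //
      Sum.elim (fun _ => (1 : L)) (fun _ => 0) i ≠ 0} ≃ Fin A.rank :=
    { toFun := fun x => match x with
        | ⟨Sum.inl i, _⟩ => i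
        | ⟨Sum.inr i, h⟩ => (h rfl).elim
      invFun := fun i => ⟨Sum.inl i, one_ne_zero⟩
      left_inv := by
        rintro ⟨i | i, h⟩
        · rfl
        · exact (h rfl).elim
      right_inv := fun _ => rfl }
  rw [Nat.card_congr this, Nat.card_eq_fintype_card, Fintype.card_fin]

theorem nullity_eq_of_rank_eq {n : ℕ} {K : Type*} [Field K] {g h : GL (Fin n) K} {Q R : K[X]}
    (hr : (aeval (h : Matrix (Fin n) (Fin n) K) R).rank =
      (aeval (g : Matrix (Fin n) (Fin n) K) Q).rank) : nullity h R = nullity g Q := by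
  have h1 := nullity_add_rank g Q
  have h2 := nullity_add_rank h R
  omega

/-- A correspondence `Q ↦ Q'` between the irreducible polynomials that matches the kernels of
their powers on `h` and on `g` carries the sequence of `g` to that of `h`. -/
theorem HasSequence.transfer {n : ℕ} {K : Type*} [Field K] {g h : GL (Fin n) K}
    {f F : ℕ+ → K[X]} (hf : HasSequence g f) (hF : ∀ i, (F i).Monic)
    (H : ∀ Q : K[X], Q.Monic → Irreducible Q → ∃ Q' : K[X], Q'.Monic ∧ Irreducible Q' ∧
      Q'.natDegree = Q.natDegree ∧ (∀ k, nullity h (Q ^ k) = nullity g (Q' ^ k)) ∧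
      ∀ i, emultiplicity Q (F i) = emultiplicity Q' (f i)) : HasSequence h F := by
  obtain ⟨f', hf'⟩ := exists_hasSequence h
  have : F = f' := funext fun i => (hF i).eq_of_emultiplicity_eq (hf'.monic i) fun Q hQm hQ => by
    obtain ⟨Q', h1, h2, h3, h4, h5⟩ := H Q hQm hQ
    rw [h5, hf.emultiplicity_eq hf' hQm hQ h1 h2 h3 h4 i]
  rwa [this]

theorem HasSequence.map_transpose {n : ℕ} {K : Type*} [Field K] {g h : GL (Fin n) K}
    {f : ℕ+ → K[X]} (hf : HasSequence g f) (σ : K ≃+* K)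
    (hh : (h : Matrix (Fin n) (Fin n) K) =
      ((g : Matrix (Fin n) (Fin n) K).map (σ : K →+* K)).transpose) :
    HasSequence h fun i => (f i).map (σ : K →+* K) := by
  have hmap : ∀ Q : K[X], (Q.map (σ.symm : K →+* K)).map (σ : K →+* K) = Q := fun Q => by
    rw [Polynomial.map_map]; simp
  refine hf.transfer (fun i => (hf.monic i).map _) fun Q hQm hQ =>
    ⟨Q.map (σ.symm : K →+* K), hQm.map _, ?_, natDegree_map _, fun k => ?_, fun i => ?_⟩
  · exact (MulEquiv.irreducible_iff (Polynomial.mapEquiv σ.symm)).2 hQ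
  · apply nullity_eq_of_rank_eq
    have h1 : ∀ R : K[X], aeval (h : Matrix (Fin n) (Fin n) K) (R.map (σ : K →+* K)) =
        ((aeval (g : Matrix (Fin n) (Fin n) K) R).map (σ : K →+* K)).transpose := by
      intro R
      rw [hh]
      induction R using Polynomial.induction_on' with
      | add p q hp hq =>
        simp only [Polynomial.map_add, map_add, hp, hq]
        rw [Matrix.map_add _ (map_add _), Matrix.transpose_add]
      | monomial k a =>
        rw [Polynomial.map_monomial, aeval_monomial, aeval_monomial, ← Matrix.transpose_pow]
        have h2 : (algebraMap K (Matrix (Fin n) (Fin n) K) a * g.val ^ k).map (σ : K →+* K) =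
            algebraMap K (Matrix (Fin n) (Fin n) K) (σ a) * (g.val.map (σ : K →+* K)) ^ k := by
          have h3 := map_pow ((σ : K →+* K).mapMatrix (m := Fin n)) g.val k
          simp only [RingHom.mapMatrix_apply] at h3
          rw [Matrix.map_mul, h3]
          congr 1
          rw [Matrix.algebraMap_eq_diagonal, Matrix.algebraMap_eq_diagonal,
            Matrix.diagonal_map (map_zero _)]
          rfl
        rw [h2, Matrix.transpose_mul]
        have h4 : (algebraMap K (Matrix (Fin n) (Fin n) K) (σ a)).transpose =
            algebraMap K (Matrix (Fin n) (Fin n) K) (σ a) := by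
          rw [Matrix.algebraMap_eq_diagonal, Matrix.diagonal_transpose]
        rw [h4]
        exact (Algebra.commutes _ _)
    conv_lhs => rw [← hmap Q, ← Polynomial.map_pow, h1]
    rw [Matrix.rank_transpose, Matrix.rank_map_of_field]
  · rw [emultiplicity_eq_emultiplicity_iff]
    intro k
    conv_lhs => rw [← hmap Q, ← Polynomial.map_pow]
    exact map_dvd_iff (Polynomial.mapEquiv σ)

theorem HasSequence.scaleRoots {n : ℕ} {K : Type*} [Field K] {g h : GL (Fin n) K}
    {f : ℕ+ → K[X]} (hf : HasSequence g f) {η : K} (hη : η ≠ 0)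
    (hh : (h : Matrix (Fin n) (Fin n) K) = algebraMap K _ η * g.val) :
    HasSequence h fun i => (f i).scaleRoots η := by
  have hs : ∀ Q : K[X], (Q.scaleRoots η⁻¹).scaleRoots η = Q := fun Q => by
    rw [← scaleRoots_mul, inv_mul_cancel₀ hη, scaleRoots_one]
  have hs' : ∀ Q : K[X], (Q.scaleRoots η).scaleRoots η⁻¹ = Q := fun Q => by
    rw [← scaleRoots_mul, mul_inv_cancel₀ hη, scaleRoots_one]
  refine hf.transfer (fun i => (monic_scaleRoots_iff _).2 (hf.monic i)) fun Q hQm hQ =>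
    ⟨Q.scaleRoots η⁻¹, (monic_scaleRoots_iff _).2 hQm, ?_, natDegree_scaleRoots _ _, fun k => ?_,
      fun i => ?_⟩
  · rw [((monic_scaleRoots_iff _).2 hQm).irreducible_iff_natDegree]
    rw [hQm.irreducible_iff_natDegree] at hQ
    refine ⟨fun h => hQ.1 ?_, fun a b ha hb hab => ?_⟩
    · rw [← hs Q, h, one_scaleRoots]
    · have := hQ.2 (a.scaleRoots η) (b.scaleRoots η) ((monic_scaleRoots_iff _).2 ha)
        ((monic_scaleRoots_iff _).2 hb) (by
          rw [← mul_scaleRoots_of_noZeroDivisors, hab, hs])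
      simpa only [natDegree_scaleRoots] using this
  · apply nullity_eq_of_rank_eq
    rw [← pow_scaleRoots_of_isReduced]
    conv_lhs => rw [← hs (Q ^ k)]
    set R := (Q ^ k).scaleRoots η⁻¹
    rw [hh]
    have h1 : aeval (algebraMap K (Matrix (Fin n) (Fin n) K) η * g.val) (R.scaleRoots η) =
        algebraMap K (Matrix (Fin n) (Fin n) K) η ^ R.natDegree * aeval g.val R :=
      scaleRoots_eval₂_mul_of_commute (algebraMap K (Matrix (Fin n) (Fin n) K)) g.val η
        (Algebra.commutes _ _) fun _ _ => (Commute.all _ _).map _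
    rw [h1, ← map_pow, ← Algebra.smul_def, Matrix.rank_smul_of_mem_nonZeroDivisors]
    exact mem_nonZeroDivisors_of_ne_zero (pow_ne_zero _ hη)
  · rw [emultiplicity_eq_emultiplicity_iff]
    intro k
    rw [← pow_scaleRoots_of_isReduced,
      ← scaleRoots_dvd_iff ((Q ^ k).scaleRoots η⁻¹) (f i) hη.isUnit, hs]

theorem nullity_X_pow {n : ℕ} {K : Type*} [Field K] (g : GL (Fin n) K) (k : ℕ) :
    nullity g (X ^ k) = 0 := by
  have h := nullity_add_rank g (X ^ k)
  rw [map_pow, aeval_X, ← Units.val_pow_eq_pow_val, Matrix.rank_unit, Fintype.card_fin] at h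
  omega

theorem HasSequence.emultiplicity_X {n : ℕ} {K : Type*} [Field K] {g : GL (Fin n) K}
    {f : ℕ+ → K[X]} (hf : HasSequence g f) (i : ℕ+) : emultiplicity X (f i) = 0 := by
  obtain ⟨m, hm, h⟩ := hf.exists_emultiplicity monic_X irreducible_X i
  simp only [nullity_X_pow, natDegree_X] at h
  rw [hm]
  have : m = 0 := by omega
  simp [this]

theorem HasSequence.coeff_zero_ne_zero {n : ℕ} {K : Type*} [Field K] {g : GL (Fin n) K}
    {f : ℕ+ → K[X]} (hf : HasSequence g f) (i : ℕ+) : (f i).coeff 0 ≠ 0 := fun h =>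
  emultiplicity_eq_zero.1 (hf.emultiplicity_X i) (X_dvd_iff.2 h)

/-- The normalized reciprocal polynomial `f(0)⁻¹ t ^ (deg f) f(t⁻¹)`. -/
noncomputable def recip {K : Type*} [Field K] (f : K[X]) : K[X] := C (f.coeff 0)⁻¹ * f.reverse

theorem recip_mul {K : Type*} [Field K] (f g : K[X]) : recip (f * g) = recip f * recip g := by
  rw [recip, recip, recip, reverse_mul_of_domain, mul_coeff_zero, mul_inv, C_mul]
  ring

theorem recip_one {K : Type*} [Field K] : recip (1 : K[X]) = 1 := by
  have : (1 : K[X]).reverse = 1 := by rw [← C_1, reverse_C]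
  simp [recip, this]

theorem recip_pow {K : Type*} [Field K] (f : K[X]) (k : ℕ) : recip (f ^ k) = recip f ^ k := by
  induction k with
  | zero => rw [pow_zero, pow_zero, recip_one]
  | succ k ih => rw [pow_succ, pow_succ, recip_mul, ih]

theorem natDegree_reverse_of_coeff_zero_ne_zero {K : Type*} [Field K] {f : K[X]}
    (h0 : f.coeff 0 ≠ 0) : f.reverse.natDegree = f.natDegree := by
  rw [reverse_natDegree, natTrailingDegree_eq_zero.2 (Or.inr h0), Nat.sub_zero]

theorem natDegree_recip {K : Type*} [Field K] {f : K[X]} (h0 : f.coeff 0 ≠ 0) :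
    (recip f).natDegree = f.natDegree := by
  rw [recip, natDegree_C_mul (inv_ne_zero h0), natDegree_reverse_of_coeff_zero_ne_zero h0]

theorem monic_recip {K : Type*} [Field K] {f : K[X]} (h0 : f.coeff 0 ≠ 0) : (recip f).Monic := by
  rw [Monic, recip, leadingCoeff_mul, leadingCoeff_C, reverse_leadingCoeff, trailingCoeff,
    natTrailingDegree_eq_zero.2 (Or.inr h0), inv_mul_cancel₀ h0]

theorem coeff_zero_recip {K : Type*} [Field K] {f : K[X]} (hf : f.Monic) :
    (recip f).coeff 0 = (f.coeff 0)⁻¹ := by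
  rw [recip, coeff_C_mul, coeff_zero_reverse, hf.leadingCoeff, mul_one]

theorem recip_recip {K : Type*} [Field K] {f : K[X]} (hf : f.Monic) (h0 : f.coeff 0 ≠ 0) :
    recip (recip f) = f := by
  rw [recip, coeff_zero_recip hf, inv_inv]
  have h1 : (recip f).reverse = C (f.coeff 0)⁻¹ * f := by
    rw [recip, reverse_mul_of_domain, reverse_C]
    congr 1
    conv_lhs => rw [reverse, natDegree_reverse_of_coeff_zero_ne_zero h0]
    rw [reverse, reflect_reflect]
  rw [h1, ← mul_assoc, ← C_mul, mul_inv_cancel₀ h0, C_1, one_mul]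

/-- A version of `Polynomial.eval₂_reflect_mul_pow` for units of algebras that need not be
commutative. -/
theorem aeval_inv_reflect_mul_pow {K A : Type*} [Field K] [Ring A] [Algebra K A] (u : Aˣ) (N : ℕ)
    (f : K[X]) (hN : f.natDegree ≤ N) :
    aeval ((u⁻¹ : Aˣ) : A) (reflect N f) * (u : A) ^ N = aeval (u : A) f := by
  refine induction_with_natDegree_le (fun f => aeval ((u⁻¹ : Aˣ) : A) (reflect N f) *
    (u : A) ^ N = aeval (u : A) f) N (by simp) ?_ ?_ f hN
  · intro n r _ hn
    rw [reflect_C_mul_X_pow, revAt_le hn, map_mul, map_mul, aeval_C, map_pow, map_pow, aeval_X,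
      aeval_X, mul_assoc, aeval_C]
    congr 1
    obtain ⟨m, rfl⟩ := Nat.exists_eq_add_of_le hn
    rw [Nat.add_sub_cancel_left, add_comm n m, pow_add, ← mul_assoc, ← Units.val_pow_eq_pow_val,
      ← Units.val_pow_eq_pow_val, ← Units.val_mul, inv_pow, inv_mul_cancel,
      Units.val_one, one_mul]
  · intro f g _ _ hf hg
    rw [reflect_add, map_add, map_add, add_mul, hf, hg]

theorem nullity_inv {n : ℕ} {K : Type*} [Field K] (g : GL (Fin n) K) {Q : K[X]}
    (h0 : Q.coeff 0 ≠ 0) : nullity g⁻¹ Q = nullity g (recip Q) := by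
  apply nullity_eq_of_rank_eq
  have h1 := aeval_inv_reflect_mul_pow g⁻¹ Q.natDegree Q le_rfl
  rw [← h1, inv_inv, recip, map_mul, aeval_C, ← Algebra.smul_def,
    Matrix.rank_smul_of_mem_nonZeroDivisors _
      (mem_nonZeroDivisors_of_ne_zero (inv_ne_zero h0)), ← Units.val_pow_eq_pow_val,
    Matrix.rank_mul_eq_left_of_isUnit_det]
  · rfl
  · exact (Matrix.isUnit_iff_isUnit_det _).1 (Units.isUnit _)

/-- The inverse of `g` has the sequence of the reciprocals. The polynomial `t`, which has no
reciprocal, divides neither sequence and is matched with itself. -/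
theorem HasSequence.inv {n : ℕ} {K : Type*} [Field K] {g : GL (Fin n) K}
    {f : ℕ+ → K[X]} (hf : HasSequence g f) : HasSequence g⁻¹ fun i => recip (f i) := by
  refine hf.transfer (fun i => monic_recip (hf.coeff_zero_ne_zero i)) fun Q hQm hQ => ?_
  by_cases h0 : Q.coeff 0 = 0
  · have hX : X = Q := eq_of_monic_of_associated monic_X hQm
      (irreducible_X.associated_of_dvd hQ (X_dvd_iff.2 h0))
    subst hX
    refine ⟨X, monic_X, irreducible_X, rfl, fun k => ?_, fun i => ?_⟩
    · rw [nullity_X_pow, nullity_X_pow]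
    · rw [hf.emultiplicity_X, emultiplicity_eq_zero, X_dvd_iff, coeff_zero_recip (hf.monic i)]
      exact inv_ne_zero (hf.coeff_zero_ne_zero i)
  · refine ⟨recip Q, monic_recip h0, ?_, natDegree_recip h0, fun k => ?_, fun i => ?_⟩
    · rw [(monic_recip h0).irreducible_iff_natDegree]
      rw [hQm.irreducible_iff_natDegree] at hQ
      refine ⟨fun h => hQ.1 ?_, fun a b ha hb hab => ?_⟩
      · rw [← recip_recip hQm h0, h, recip_one]
      · have hab0 : a.coeff 0 * b.coeff 0 ≠ 0 := by
          rw [← mul_coeff_zero, hab, coeff_zero_recip hQm]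
          exact inv_ne_zero h0
        have ha0 := left_ne_zero_of_mul hab0
        have hb0 := right_ne_zero_of_mul hab0
        rw [← natDegree_recip ha0, ← natDegree_recip hb0]
        refine hQ.2 (recip a) (recip b) (monic_recip ha0) (monic_recip hb0) ?_
        rw [← recip_mul, hab, recip_recip hQm h0]
    · rw [nullity_inv, recip_pow]
      rw [coeff_zero_eq_eval_zero, eval_pow, ← coeff_zero_eq_eval_zero]
      exact pow_ne_zero _ h0
    · rw [emultiplicity_eq_emultiplicity_iff]
      have hdvd : ∀ {a b : K[X]}, a ∣ b → recip a ∣ recip b := by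
        rintro a _ ⟨c, rfl⟩
        exact ⟨_, recip_mul a c⟩
      intro k
      constructor
      · intro h
        have := hdvd h
        rwa [recip_pow, recip_recip (hf.monic i) (hf.coeff_zero_ne_zero i)] at this
      · intro h
        have := hdvd h
        rwa [recip_pow, recip_recip hQm h0] at this

/-! ### Conjugacy in the unitary group -/

/-- In a finite commutative ring of odd prime characteristic the form `a ^ 2 - d * b ^ 2`, with `d` a
unit, represents every unit. -/
theorem exists_sq_sub_mul_sq_eq {R : Type*} [CommRing R] [Finite R] {p : ℕ} [hp : Fact p.Prime]
    (hodd : p ≠ 2) (hpR : (p : R) = 0) {s d : R} (hs : IsUnit s) (hd : IsUnit d) :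
    ∃ a b : R, a ^ 2 - d * b ^ 2 = s := by
  classical
  rcases subsingleton_or_nontrivial R with _ | _
  · exact ⟨0, 0, Subsingleton.elim _ _⟩
  have hfield : ∀ m : MaximalSpectrum R, ∃ a b : R ⧸ m.asIdeal,
      a ^ 2 - Ideal.Quotient.mk _ d * b ^ 2 = Ideal.Quotient.mk _ s := by
    intro m
    have : Finite (R ⧸ m.asIdeal) := Finite.of_surjective _ Ideal.Quotient.mk_surjective
    let : Field (R ⧸ m.asIdeal) := @Ideal.Quotient.field _ _ _ m.isMaximal
    let : Fintype (R ⧸ m.asIdeal) := Fintype.ofFinite _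
    have hd0 : Ideal.Quotient.mk m.asIdeal d ≠ 0 := (hd.map (Ideal.Quotient.mk m.asIdeal)).ne_zero
    have hchar : ringChar (R ⧸ m.asIdeal) = p := by
      apply CharP.ringChar_of_prime_eq_zero hp.out
      rw [← map_natCast (Ideal.Quotient.mk m.asIdeal), hpR, map_zero]
    obtain ⟨a, b, hab⟩ := FiniteField.exists_root_sum_quadratic
      (f := (X ^ 2 - C (Ideal.Quotient.mk m.asIdeal s)))
      (g := (C (-Ideal.Quotient.mk m.asIdeal d) * X ^ 2)) (degree_X_pow_sub_C two_pos _)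
      (degree_C_mul_X_pow 2 (neg_ne_zero.2 hd0))
      (FiniteField.odd_card_of_char_ne_two (by rwa [hchar]))
    refine ⟨a, b, ?_⟩
    simp only [eval_sub, eval_pow, eval_X, eval_C, eval_mul] at hab
    linear_combination hab
  choose a b hab using hfield
  obtain ⟨a', ha'⟩ := (IsArtinianRing.quotNilradicalEquivPi R).surjective a
  obtain ⟨b', hb'⟩ := (IsArtinianRing.quotNilradicalEquivPi R).surjective b
  obtain ⟨α, rfl⟩ := Ideal.Quotient.mk_surjective a'
  obtain ⟨β, rfl⟩ := Ideal.Quotient.mk_surjective b'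
  have hα : ∀ m, Ideal.Quotient.mk _ α = a m := fun m => congrFun ha' m
  have hβ : ∀ m, Ideal.Quotient.mk _ β = b m := fun m => congrFun hb' m
  have hnil : IsNilpotent (α ^ 2 - d * β ^ 2 - s) := by
    rw [← mem_nilradical, nilradical_eq_sInf, Ideal.mem_sInf]
    intro I hI
    have hIp : I.IsPrime := hI
    have hI' : I.IsMaximal := IsArtinianRing.isMaximal_of_isPrime I
    rw [← Ideal.Quotient.eq_zero_iff_mem]
    have h1 := hab ⟨I, hI'⟩
    rw [← hα, ← hβ] at h1
    simp only [map_sub, map_mul, map_pow]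
    exact sub_eq_zero.2 h1
  obtain ⟨u, rfl⟩ := hs
  set x : R := (↑u⁻¹ : R) * (α ^ 2 - d * β ^ 2 - u) with hx
  have hxnil : IsNilpotent x := (Commute.all _ _).isNilpotent_mul_left hnil
  obtain ⟨N, hN⟩ := hxnil
  have : CharP R p := by
    rw [← CharP.ringChar_of_prime_eq_zero hp.out hpR]
    infer_instance
  -- `1 + x` has odd order `p ^ N`, so it is a square.
  have h1 : (1 + x) ^ p ^ N = 1 := by
    rw [add_pow_char_pow, one_pow, add_eq_left]
    exact pow_eq_zero_of_le (Nat.lt_pow_self hp.out.one_lt).le hN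
  have hpodd : Odd (p ^ N) := (hp.out.odd_of_ne_two hodd).pow
  obtain ⟨k, hk⟩ := hpodd
  have h2 : ((1 + x) ^ (k + 1)) ^ 2 = 1 + x := by
    rw [← pow_mul, show (k + 1) * 2 = p ^ N + 1 by omega, pow_succ, h1, one_mul]
  have h3 : ((1 + x) ^ k) ^ 2 * (1 + x) = 1 := by
    rw [← pow_mul, ← pow_succ, show k * 2 + 1 = p ^ N by omega, h1]
  refine ⟨α * (1 + x) ^ k, β * (1 + x) ^ k, ?_⟩
  have h4 : α ^ 2 - d * β ^ 2 = u * (1 + x) := by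
    rw [hx, mul_add, ← mul_assoc, Units.mul_inv]
    ring
  calc (α * (1 + x) ^ k) ^ 2 - d * (β * (1 + x) ^ k) ^ 2
      = (α ^ 2 - d * β ^ 2) * ((1 + x) ^ k) ^ 2 := by ring
    _ = u * (((1 + x) ^ k) ^ 2 * (1 + x)) := by rw [h4]; ring
    _ = u := by rw [h3, mul_one]

theorem Subring.isUnit_mk_of_finite {A : Type*} [Ring A] [Finite A] {R : Subring A} {s : A}
    (hs : s ∈ R) (h : IsUnit s) : IsUnit (⟨s, hs⟩ : R) := by
  obtain ⟨u, rfl⟩ := h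
  refine IsUnit.of_pow_eq_one (n := orderOf u) (Subtype.ext ?_) (orderOf_pos u).ne'
  simp [← Units.val_pow_eq_pow_val, pow_orderOf_eq_one]

section FieldOfSquareCard

variable {p k : ℕ} [hp : Fact p.Prime] {K : Type*} [Field K]

theorem finite_of_card_eq {K : Type*} (hK : Nat.card K = (p ^ k) ^ 2) : Finite K :=
  Nat.finite_of_card_ne_zero (by rw [hK]; exact pow_ne_zero _ (pow_ne_zero _ hp.out.ne_zero))

/-- The unit group of the field with `q ^ 2` elements has a generator, of order `(q - 1) (q + 1)`. -/
theorem exists_orderOf_eq (hK : Nat.card K = (p ^ k) ^ 2) :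
    ∃ z : Kˣ, orderOf z = (p ^ k - 1) * (p ^ k + 1) := by
  have : Finite K := finite_of_card_eq hK
  obtain ⟨z, hz⟩ := IsCyclic.exists_generator (α := Kˣ)
  refine ⟨z, ?_⟩
  rw [orderOf_eq_card_of_forall_mem_zpowers hz, Nat.card_units, hK]
  have := Nat.sq_sub_sq (p ^ k) 1
  rw [one_pow] at this
  rw [this, mul_comm]

theorem one_lt_of_card (hK : Nat.card K = (p ^ k) ^ 2) : 1 < p ^ k := by
  have : Finite K := finite_of_card_eq hK
  have h1 := Finite.one_lt_card (α := K)
  rw [hK] at h1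
  by_contra h
  have : p ^ k ≤ 1 := not_lt.1 h
  have := Nat.pow_le_one_iff (n := 2) (by norm_num) |>.2 this
  omega

variable [CharP K p]

theorem qFrob_qFrob (hK : Nat.card K = (p ^ k) ^ 2) (x : K) :
    qFrob p k K (qFrob p k K x) = x := by
  have : Finite K := finite_of_card_eq hK
  have := Fintype.ofFinite K
  rw [iterateFrobenius_def, iterateFrobenius_def, ← pow_mul, ← sq, ← hK,
    Nat.card_eq_fintype_card, FiniteField.pow_card]

/-- A nonzero `δ` with `δ ^ q = -δ`: take `z - z ^ q` for a generator `z` of the unit group. -/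
theorem exists_qFrob_eq_neg (hK : Nat.card K = (p ^ k) ^ 2) :
    ∃ δ : K, δ ≠ 0 ∧ qFrob p k K δ = -δ := by
  obtain ⟨z, hz⟩ := exists_orderOf_eq hK
  have hq := one_lt_of_card hK
  refine ⟨(z : K) - qFrob p k K z, fun h => ?_, by rw [map_sub, qFrob_qFrob hK, neg_sub]⟩
  rw [iterateFrobenius_def, sub_eq_zero, ← Units.val_pow_eq_pow_val, Units.val_inj] at h
  have h1 : z ^ (p ^ k - 1) = 1 := by
    have h2 : z ^ (p ^ k - 1) * z = 1 * z := by
      rw [← pow_succ, Nat.sub_add_cancel hq.le, one_mul, ← h]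
    exact mul_right_cancel h2
  have h2 := orderOf_dvd_of_pow_eq_one h1
  rw [hz] at h2
  have h3 := Nat.le_of_dvd (by omega) h2
  have : (p ^ k - 1) * 1 < (p ^ k - 1) * (p ^ k + 1) :=
    Nat.mul_lt_mul_of_pos_left (by omega) (by omega)
  omega

/-- The conjugate transpose of a matrix with respect to the `q`-power map. -/
noncomputable def adj (p k : ℕ) [Fact p.Prime] {K : Type*} [Field K] [CharP K p] {n : ℕ}
    (M : Matrix (Fin n) (Fin n) K) : Matrix (Fin n) (Fin n) K := (M.map (qFrob p k K)).transpose

theorem adj_mul {n : ℕ} (M N : Matrix (Fin n) (Fin n) K) :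
    adj p k (M * N) = adj p k N * adj p k M := by
  rw [adj, Matrix.map_mul, Matrix.transpose_mul, adj, adj]

theorem adj_add {n : ℕ} (M N : Matrix (Fin n) (Fin n) K) :
    adj p k (M + N) = adj p k M + adj p k N := by
  rw [adj, Matrix.map_add _ (map_add _), Matrix.transpose_add, adj, adj]

theorem adj_neg {n : ℕ} (M : Matrix (Fin n) (Fin n) K) : adj p k (-M) = -adj p k M := by
  ext; simp [adj]

theorem adj_smul {n : ℕ} (c : K) (M : Matrix (Fin n) (Fin n) K) :
    adj p k (c • M) = qFrob p k K c • adj p k M := by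
  ext; simp [adj, iterateFrobenius_def, mul_pow]

theorem adj_one {n : ℕ} : adj p k (1 : Matrix (Fin n) (Fin n) K) = 1 := by
  simp [adj]

theorem adj_zero {n : ℕ} : adj p k (0 : Matrix (Fin n) (Fin n) K) = 0 := by
  ext i j
  exact map_zero (qFrob p k K)

theorem adj_adj (hK : Nat.card K = (p ^ k) ^ 2) {n : ℕ} (M : Matrix (Fin n) (Fin n) K) :
    adj p k (adj p k M) = M := by
  ext i j
  exact qFrob_qFrob hK _

theorem mem_unitaryGrp_iff {n : ℕ} {g : GL (Fin n) K} :
    g ∈ unitaryGrp p k n K ↔ adj p k g.val * g.val = 1 := Iff.rfl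

open scoped IsMulCommutative in
/-- An invertible hermitian matrix `s` has the form `y* y` where `y` commutes with everything that
commutes with `s`. -/
theorem exists_adj_mul_self (hq : Odd (p ^ k)) (hK : Nat.card K = (p ^ k) ^ 2) {n : ℕ}
    {s : Matrix (Fin n) (Fin n) K} (hs : IsUnit s) (hadj : adj p k s = s) :
    ∃ y : Matrix (Fin n) (Fin n) K, IsUnit y ∧ adj p k y * y = s ∧
      ∀ g, Commute g s → Commute g y := by
  have : Finite K := finite_of_card_eq hK
  have : Finite (Matrix (Fin n) (Fin n) K) := inferInstanceAs (Finite (Fin n → Fin n → K))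
  have hp2 : p ≠ 2 := by
    rintro rfl
    have h1 := one_lt_of_card hK
    rcases Nat.eq_zero_or_pos k with rfl | hk
    · simp at h1
    · exact (Nat.not_even_iff_odd.2 hq) ((even_two).pow_of_ne_zero hk.ne')
  obtain ⟨δ, hδ0, hδ⟩ := exists_qFrob_eq_neg hK
  -- The ring `R` generated by `s` and `δ ^ 2` consists of commuting hermitian matrices.
  let D : Matrix (Fin n) (Fin n) K := (δ * δ) • 1
  have hDcomm : ∀ M, Commute M D := fun M => (Commute.one_right M).smul_right _
  have hcomm : ∀ x ∈ ({s, D} : Set (Matrix (Fin n) (Fin n) K)),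
      ∀ y ∈ ({s, D} : Set (Matrix (Fin n) (Fin n) K)), x * y = y * x := by
    rintro x (rfl | rfl) y (rfl | rfl)
    · rfl
    · exact hDcomm _
    · exact (hDcomm _).symm
    · rfl
  let R := Subring.closure ({s, D} : Set (Matrix (Fin n) (Fin n) K))
  have hRc : IsMulCommutative R := Subring.isMulCommutative_closure hcomm
  let : CommRing R := inferInstance
  have hsR : s ∈ R := Subring.subset_closure (Set.mem_insert _ _)
  have hDR : D ∈ R := Subring.subset_closure (Set.mem_insert_of_mem _ rfl)
  have hcommR : ∀ a ∈ R, ∀ b ∈ R, a * b = b * a := fun a ha b hb =>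
    congrArg Subtype.val (mul_comm (⟨a, ha⟩ : R) ⟨b, hb⟩)
  have hherm : ∀ a ∈ R, adj p k a = a := by
    intro a ha
    induction ha using Subring.closure_induction with
    | mem x hx =>
      rcases hx with rfl | rfl
      · exact hadj
      · rw [adj_smul, adj_one, map_mul, hδ, neg_mul_neg]
    | zero => exact adj_zero
    | one => exact adj_one
    | add x y _ _ hx hy => rw [adj_add, hx, hy]
    | neg x _ hx => rw [adj_neg, hx]
    | mul x y hxR hyR hx hy => rw [adj_mul, hx, hy, hcommR _ hyR _ hxR]
  have hcent : ∀ g, Commute g s → ∀ a ∈ R, Commute g a := by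
    intro g hg a ha
    induction ha using Subring.closure_induction with
    | mem x hx =>
      rcases hx with rfl | rfl
      · exact hg
      · exact hDcomm g
    | zero => exact Commute.zero_right g
    | one => exact Commute.one_right g
    | add x y _ _ hx hy => exact hx.add_right hy
    | neg x _ hx => exact hx.neg_right
    | mul x y _ _ hx hy => exact hx.mul_right hy
  have hDu : IsUnit D := by
    have : IsUnit ((δ * δ) • (1 : Matrix (Fin n) (Fin n) K)) := by
      rw [← Algebra.algebraMap_eq_smul_one]
      exact (mul_ne_zero hδ0 hδ0).isUnit.map _
    exact this
  have hpR : (p : R) = 0 := by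
    apply Subtype.ext
    have h1 : ((p : K) • (1 : Matrix (Fin n) (Fin n) K)) = 0 := by
      rw [CharP.cast_eq_zero, zero_smul]
    rw [← Algebra.algebraMap_eq_smul_one, map_natCast] at h1
    simpa using h1
  obtain ⟨⟨a, ha⟩, ⟨b, hb⟩, hab⟩ := exists_sq_sub_mul_sq_eq hp2 hpR
    (Subring.isUnit_mk_of_finite hsR hs) (Subring.isUnit_mk_of_finite hDR hDu)
  have hab' : a ^ 2 - D * b ^ 2 = s := congrArg Subtype.val hab
  have hy : adj p k (a + δ • b) * (a + δ • b) = s := by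
    rw [adj_add, adj_smul, hherm a ha, hherm b hb, hδ, ← hab', neg_smul, ← sub_eq_add_neg,
      sub_mul, mul_add, mul_add, smul_mul_assoc, mul_smul_comm, smul_mul_smul_comm,
      hcommR b hb a ha, smul_mul_assoc, one_mul, sq, sq]
    abel
  refine ⟨a + δ • b, ?_, hy, fun g hg =>
    (hcent g hg a ha).add_right ((hcent g hg b hb).smul_right _)⟩
  rw [Matrix.isUnit_iff_isUnit_det] at hs ⊢
  rw [← hy, Matrix.det_mul] at hs
  exact isUnit_of_mul_isUnit_right hs

/-- Elements of `U(n, q)` that are conjugate in `GL(n, K)` are conjugate in `U(n, q)`: if `x`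
conjugates `g` to `h`, then `x* x = y* y` with `y` commuting with `g`, and `x y⁻¹` is unitary. -/
theorem isConj_of_conj_in_GL (hq : Odd (p ^ k)) (hK : Nat.card K = (p ^ k) ^ 2) {n : ℕ}
    (g h : unitaryGrp p k n K) (x : GL (Fin n) K) (hx : x * g.1 = h.1 * x) : IsConj g h := by
  have hg : adj p k g.1.val * g.1.val = 1 := g.2
  have hh : adj p k h.1.val * h.1.val = 1 := h.2
  have hx' : x.val * g.1.val = h.1.val * x.val := congrArg Units.val hx
  have hg' : g.1.val * adj p k g.1.val = 1 := mul_eq_one_comm.1 hg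
  have hadjx : IsUnit (adj p k x.val) := by
    have h1 : adj p k x.val * adj p k (x⁻¹ : GL (Fin n) K).val = 1 := by
      rw [← adj_mul, ← Units.val_mul, inv_mul_cancel, Units.val_one, adj_one]
    exact IsUnit.of_mul_eq_one _ h1
  have hcomm : Commute g.1.val (adj p k x.val * x.val) := by
    have h1 : adj p k g.1.val * (adj p k x.val * x.val) * g.1.val = adj p k x.val * x.val := by
      calc adj p k g.1.val * (adj p k x.val * x.val) * g.1.val
          = adj p k (x.val * g.1.val) * (x.val * g.1.val) := by rw [adj_mul]; noncomm_ring
        _ = adj p k x.val * (adj p k h.1.val * h.1.val) * x.val := by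
          rw [hx', adj_mul]; noncomm_ring
        _ = adj p k x.val * x.val := by rw [hh, mul_one]
    calc g.1.val * (adj p k x.val * x.val)
        = g.1.val * (adj p k g.1.val * (adj p k x.val * x.val) * g.1.val) := by rw [h1]
      _ = g.1.val * adj p k g.1.val * (adj p k x.val * x.val) * g.1.val := by noncomm_ring
      _ = adj p k x.val * x.val * g.1.val := by rw [hg', one_mul]
  obtain ⟨y, ⟨y, rfl⟩, hy, hyc⟩ := exists_adj_mul_self hq hK (s := adj p k x.val * x.val)
    (hadjx.mul x.isUnit) (by rw [adj_mul, adj_adj hK])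
  have hyg : g.1 * y = y * g.1 := Units.ext (hyc _ hcomm)
  have hu : x * y⁻¹ ∈ unitaryGrp p k n K := by
    rw [mem_unitaryGrp_iff, Units.val_mul, adj_mul]
    have h1 : adj p k (y⁻¹ : GL (Fin n) K).val * adj p k y.val = 1 := by
      rw [← adj_mul, ← Units.val_mul, mul_inv_cancel, Units.val_one, adj_one]
    calc adj p k (y⁻¹ : GL (Fin n) K).val * adj p k x.val * (x.val * (y⁻¹ : GL (Fin n) K).val)
        = adj p k (y⁻¹ : GL (Fin n) K).val * (adj p k x.val * x.val) *
          (y⁻¹ : GL (Fin n) K).val := by noncomm_ring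
      _ = (adj p k (y⁻¹ : GL (Fin n) K).val * adj p k y.val) *
          (y.val * (y⁻¹ : GL (Fin n) K).val) := by rw [← hy]; noncomm_ring
      _ = 1 := by rw [h1, one_mul, ← Units.val_mul, mul_inv_cancel, Units.val_one]
  rw [isConj_iff]
  refine ⟨⟨_, hu⟩, Subtype.ext ?_⟩
  change x * y⁻¹ * g.1 * (x * y⁻¹)⁻¹ = h.1
  rw [mul_inv_eq_iff_eq_mul, ← mul_assoc, ← hx, mul_assoc, mul_assoc, inv_mul_eq_iff_eq_mul.2]
  rw [← mul_assoc, ← hyg, mul_inv_cancel_right]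

end FieldOfSquareCard

/-! ### Square roots in quotients of a finite cyclic group -/

theorem encard_sq_eq_of_odd_card {Q : Type*} [CommGroup Q] (h : Odd (Nat.card Q)) (a : Q) :
    {x : Q | x ^ 2 = a}.encard = 1 := by
  have hc : (Nat.card Q).Coprime 2 := h.coprime_two_right
  rw [Set.encard_eq_one]
  refine ⟨(powCoprime hc).symm a, Set.ext fun x => ?_⟩
  rw [Set.mem_singleton_iff, Equiv.eq_symm_apply]
  rfl

theorem encard_sq_eq_sq_of_even_card {Q : Type*} [CommGroup Q] [Finite Q] [IsCyclic Q]
    (h : Even (Nat.card Q)) (y : Q) : {x : Q | x ^ 2 = y ^ 2}.encard = 2 := by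
  classical
  have := Fintype.ofFinite Q
  obtain ⟨t, ht⟩ := exists_prime_orderOf_dvd_card' (G := Q) 2 h.two_dvd
  have ht1 : t ≠ 1 := by
    rintro rfl
    simp at ht
  have ht2 : t ^ 2 = 1 := by rw [← ht, pow_orderOf_eq_one]
  have hS : ∀ x : Q, x ^ 2 = 1 → x = 1 ∨ x = t := by
    intro x hx
    by_contra! hcon
    have h1 : ({1, t, x} : Finset Q) ⊆ Finset.univ.filter fun a => a ^ 2 = 1 := by
      intro a ha
      simp only [Finset.mem_insert, Finset.mem_singleton] at ha
      rw [Finset.mem_filter]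
      refine ⟨Finset.mem_univ _, ?_⟩
      rcases ha with rfl | rfl | rfl
      · exact one_pow 2
      · exact ht2
      · exact hx
    have h2 := (Finset.card_le_card h1).trans (IsCyclic.card_pow_eq_one_le two_pos)
    rw [Finset.card_eq_three.2 ⟨1, t, x, ht1.symm, hcon.1.symm, hcon.2.symm, rfl⟩] at h2
    omega
  have : {x : Q | x ^ 2 = y ^ 2} = {y, y * t} := by
    ext x
    simp only [Set.mem_ofPred_eq, Set.mem_insert_iff, Set.mem_singleton_iff]
    constructor
    · intro hx
      rcases hS (y⁻¹ * x) (by rw [mul_pow, hx, inv_pow, inv_mul_cancel]) with h | h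
      · exact Or.inl (inv_mul_eq_one.1 h).symm
      · exact Or.inr (inv_mul_eq_iff_eq_mul.1 h)
    · rintro (rfl | rfl)
      · rfl
      · rw [mul_pow, ht2, mul_one]
  rw [this, Set.encard_pair]
  exact fun h => ht1 (left_eq_mul.1 h)

/-- In a quotient of even order of a cyclic group, exactly one of `s` and `ζ s` is a square if `ζ`
is not a square upstairs. -/
theorem encard_sq_eq_of_even_card {G : Type*} [CommGroup G] [Finite G] [IsCyclic G]
    (H : Subgroup G) (h : Even (Nat.card (G ⧸ H))) {ζ : G} (hζ : ¬ IsSquare ζ) (s : G) :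
    ({x : G ⧸ H | x ^ 2 = ((1 * s : G) : G ⧸ H)}.encard = 2 ∧
      {x : G ⧸ H | x ^ 2 = ((ζ * s : G) : G ⧸ H)}.encard = 0) ∨
    ({x : G ⧸ H | x ^ 2 = ((1 * s : G) : G ⧸ H)}.encard = 0 ∧
      {x : G ⧸ H | x ^ 2 = ((ζ * s : G) : G ⧸ H)}.encard = 2) := by
  obtain ⟨z, hz⟩ := IsCyclic.exists_generator (α := G)
  have : IsCyclic (G ⧸ H) :=
    isCyclic_of_surjective (QuotientGroup.mk' H) (QuotientGroup.mk'_surjective H)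
  have hz' : ∀ x : G ⧸ H, x ∈ Subgroup.zpowers (z : G ⧸ H) := by
    intro x
    obtain ⟨x, rfl⟩ := QuotientGroup.mk_surjective x
    obtain ⟨i, rfl⟩ := hz x
    exact ⟨i, rfl⟩
  have hord : Even (orderOf (z : G ⧸ H)) := by
    rwa [orderOf_eq_card_of_forall_mem_zpowers hz']
  have hsq : ∀ i : ℤ, Even i →
      {x : G ⧸ H | x ^ 2 = ((z ^ i : G) : G ⧸ H)}.encard = 2 := by
    rintro _ ⟨j, rfl⟩
    rw [show ((z ^ (j + j) : G) : G ⧸ H) = ((z ^ j : G) : G ⧸ H) ^ 2 by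
      rw [zpow_add, sq]; rfl]
    exact encard_sq_eq_sq_of_even_card h _
  have hnsq : ∀ i : ℤ, ¬ Even i →
      {x : G ⧸ H | x ^ 2 = ((z ^ i : G) : G ⧸ H)}.encard = 0 := by
    intro i hi
    rw [Set.encard_eq_zero, Set.eq_empty_iff_forall_notMem]
    intro x hx
    obtain ⟨j, rfl⟩ := hz' x
    have h1 : (z : G ⧸ H) ^ (j * 2) = (z : G ⧸ H) ^ i := by
      rw [zpow_mul]
      simpa using hx
    have h2 := (orderOf_dvd_sub_iff_zpow_eq_zpow (a := j * 2) (b := i)).2 h1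
    have h3 : (2 : ℤ) ∣ j * 2 - i := (Int.natCast_dvd_natCast.2 hord.two_dvd).trans h2
    exact hi (even_iff_two_dvd.2 (by omega))
  obtain ⟨i, rfl⟩ := hz s
  obtain ⟨j, rfl⟩ := hz ζ
  have hj : ¬ Even j := by
    rintro ⟨l, rfl⟩
    exact hζ ⟨z ^ l, zpow_add _ _ _⟩
  simp only [one_mul, ← zpow_add]
  by_cases hi : Even i
  · exact Or.inl ⟨hsq i hi, hnsq _ (by rw [Int.even_add]; tauto)⟩
  · exact Or.inr ⟨hnsq i hi, hsq _ (by rw [Int.even_add]; tauto)⟩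

/-- If the order of `ω` is the full `2`-part of the group order, then the index of `H` is odd if and
only if `ω` lies in `H`. -/
theorem odd_card_quotient_iff {G : Type*} [CommGroup G] [Finite G] (H : Subgroup G) {ω : G}
    (hω : orderOf ω = twoPart (Nat.card G)) : Odd (Nat.card (G ⧸ H)) ↔ ω ∈ H := by
  constructor
  · intro h
    rw [← QuotientGroup.eq_one_iff]
    have h1 : (ω : G ⧸ H) ^ Nat.card (G ⧸ H) = 1 := pow_card_eq_one'
    have h2 : (ω : G ⧸ H) ^ (2 ^ padicValNat 2 (Nat.card G)) = 1 := by
      rw [← QuotientGroup.mk_pow, ← twoPart, ← hω, pow_orderOf_eq_one, QuotientGroup.mk_one]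
    have h3 : Nat.Coprime (Nat.card (G ⧸ H)) (2 ^ padicValNat 2 (Nat.card G)) :=
      (h.coprime_two_right).pow_right _
    rw [← orderOf_eq_one_iff]
    exact Nat.eq_one_of_dvd_coprimes h3 (orderOf_dvd_of_pow_eq_one h1)
      (orderOf_dvd_of_pow_eq_one h2)
  · intro h
    by_contra hodd
    rw [Nat.not_odd_iff_even] at hodd
    have h1 : twoPart (Nat.card G) ∣ Nat.card H := by
      rw [← hω, ← Subgroup.orderOf_mk ω h]
      exact orderOf_dvd_natCard _
    have h2 := mul_dvd_mul hodd.two_dvd h1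
    rw [← Subgroup.card_eq_card_quotient_mul_card_subgroup, twoPart, ← pow_succ'] at h2
    exact pow_succ_padicValNat_not_dvd (Nat.card_pos.ne') h2

/-! ### Polynomials in `t ^ m` -/

theorem reverse_expand {K : Type*} [Field K] {m : ℕ} (hm : 0 < m) (h : K[X]) :
    (expand K m h).reverse = expand K m h.reverse := by
  ext j
  rw [coeff_reverse, coeff_expand hm, coeff_expand hm, natDegree_expand]
  by_cases hj : j ≤ h.natDegree * m
  · rw [revAt_le hj]
    have hdm : m ∣ h.natDegree * m := dvd_mul_left _ _
    by_cases hd : m ∣ j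
    · obtain ⟨t, rfl⟩ := hd
      have ht : t ≤ h.natDegree := by
        rw [mul_comm] at hj
        exact Nat.le_of_mul_le_mul_right hj hm
      rw [if_pos (Nat.dvd_sub hdm (dvd_mul_right _ _)), if_pos (dvd_mul_right _ _), coeff_reverse,
        Nat.mul_div_cancel_left _ hm, revAt_le ht, mul_comm, ← Nat.mul_sub,
        Nat.mul_div_cancel_left _ hm]
    · rw [if_neg hd, if_neg]
      intro h'
      exact hd ((Nat.dvd_sub_iff_right hj hdm).1 h')
  · rw [revAt_eq_self_of_lt (not_le.1 hj)]
    split_ifs with hd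
    · obtain ⟨t, rfl⟩ := hd
      have ht : h.natDegree < t := by
        rw [mul_comm m t] at hj
        exact lt_of_mul_lt_mul_right (not_le.1 hj) (Nat.zero_le _)
      rw [Nat.mul_div_cancel_left _ hm, coeff_reverse, revAt_eq_self_of_lt ht]
    · rfl

section FieldOfSquareCard

variable {p k : ℕ} [hp : Fact p.Prime] {K : Type*} [Field K] [CharP K p]

theorem conjPoly_expand {m : ℕ} (hm : 0 < m) (h : K[X]) :
    conjPoly p k (expand K m h) = expand K m (conjPoly p k h) := by
  rw [conjPoly, conjPoly, map_expand, reverse_expand hm, map_mul, expand_C, coeff_expand hm]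
  simp

theorem conjPoly_eq_recip (f : K[X]) : conjPoly p k f = recip (f.map (qFrob p k K)) := by
  rw [conjPoly, recip, coeff_map, iterateFrobenius_def]

/-- A self-conjugate polynomial is fixed by an element of order `m` if and only if only the powers
`t ^ j` with `m ∣ j` occur in it; the constant term, which is not zero, forces `m ∣ deg f`. -/
theorem scaleRoots_eq_self_iff {f : K[X]} (hf : f ∈ UPoly p k K) {ω : K} {m : ℕ} (hm : 0 < m)
    (hω : orderOf ω = m) : f.scaleRoots ω = f ↔ f ∈ UPolyPow p k K m := by
  obtain ⟨hmon, h0, hconj⟩ := hf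
  constructor
  · intro h
    have h1 : ∀ j, f.coeff j ≠ 0 → m ∣ f.natDegree - j := by
      intro j hj
      have h2 := congrArg (fun g => g.coeff j) h
      simp only [coeff_scaleRoots] at h2
      rw [← hω]
      exact orderOf_dvd_of_pow_eq_one (mul_left_cancel₀ hj (by rw [h2, mul_one]))
    have hdeg : m ∣ f.natDegree := h1 0 h0
    have h3 : f = expand K m (contract m f) := by
      ext j
      rw [coeff_expand hm]
      split_ifs with hd
      · rw [coeff_contract hm.ne', Nat.div_mul_cancel hd]
      · by_contra hj
        exact hd ((Nat.dvd_sub_iff_right (le_natDegree_of_ne_zero hj) hdeg).1 (h1 j hj))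
    refine ⟨contract m f, ⟨?_, ?_, ?_⟩, h3⟩
    · rw [h3] at hmon
      exact (monic_expand_iff hm).1 hmon
    · rwa [coeff_contract hm.ne', zero_mul]
    · apply expand_injective hm
      rw [← conjPoly_expand hm, ← h3, ← hconj]
  · rintro ⟨h, -, rfl⟩
    ext j
    rw [coeff_scaleRoots]
    by_cases hj : (expand K m h).coeff j = 0
    · rw [hj, zero_mul]
    · have hd : m ∣ j := by
        by_contra hd
        rw [coeff_expand hm, if_neg hd] at hj
        exact hj rfl
      have h2 : m ∣ (expand K m h).natDegree - j := by
        rw [natDegree_expand]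
        exact Nat.dvd_sub (dvd_mul_left _ _) hd
      rw [orderOf_dvd_iff_pow_eq_one.1 (hω.symm ▸ h2), mul_one]

end FieldOfSquareCard

section FieldOfSquareCard

variable {p k : ℕ} {K : Type*} [Field K]

/-! ### The action of `C_{q+1}` on sequences -/

/-- The sequence `η.f`, with `η ∈ C_{q+1}` acting termwise. -/
noncomputable def seqScale (η : CGroup p k K) (f : ℕ+ → K[X]) : ℕ+ → K[X] :=
  fun i => (f i).scaleRoots ((η : Kˣ) : K)

theorem seqScale_one (f : ℕ+ → K[X]) : seqScale (1 : CGroup p k K) f = f :=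
  funext fun i => scaleRoots_one (f i)

theorem seqScale_mul (η θ : CGroup p k K) (f : ℕ+ → K[X]) :
    seqScale (η * θ) f = seqScale η (seqScale θ f) :=
  funext fun i => by
    rw [seqScale, mul_comm]
    exact scaleRoots_mul (f i) _ _

theorem seqScale_eq_iff (η : CGroup p k K) (f F : ℕ+ → K[X]) :
    seqScale η f = F ↔ f = seqScale η⁻¹ F := by
  constructor
  · rintro rfl
    rw [← seqScale_mul, inv_mul_cancel, seqScale_one]
  · rintro rfl
    rw [← seqScale_mul, mul_inv_cancel, seqScale_one]

/-- The stabilizer of a sequence in `C_{q+1}`. -/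
def seqStabilizer (p k : ℕ) (f : ℕ+ → K[X]) : Subgroup (CGroup p k K) where
  carrier := {η | seqScale η f = f}
  one_mem' := seqScale_one f
  mul_mem' {a b} ha hb := by
    have ha : seqScale a f = f := ha
    have hb : seqScale b f = f := hb
    exact (seqScale_mul a b f).trans (by rw [hb, ha])
  inv_mem' {a} ha := ((seqScale_eq_iff a f f).1 ha).symm

theorem mem_seqStabilizer {η : CGroup p k K} {f : ℕ+ → K[X]} :
    η ∈ seqStabilizer p k f ↔ seqScale η f = f := Iff.rfl

theorem seqScale_eq_seqScale_iff {η θ : CGroup p k K} {f : ℕ+ → K[X]} :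
    seqScale η f = seqScale θ f ↔
      (η : CGroup p k K ⧸ seqStabilizer p k f) = (θ : CGroup p k K ⧸ seqStabilizer p k f) := by
  rw [QuotientGroup.eq, mem_seqStabilizer, seqScale_eq_iff, ← seqScale_mul, eq_comm]

theorem natCard_CGroup [Fact p.Prime] (hK : Nat.card K = (p ^ k) ^ 2) :
    Nat.card (CGroup p k K) = p ^ k + 1 := by
  obtain ⟨z, hz⟩ := exists_orderOf_eq hK
  have hq := one_lt_of_card hK
  have h1 : IsPrimitiveRoot z ((p ^ k - 1) * (p ^ k + 1)) := hz ▸ IsPrimitiveRoot.orderOf z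
  exact (h1.pow (Nat.mul_pos (by omega) (by omega)) rfl).card_rootsOfUnity'

variable [hp : Fact p.Prime] [CharP K p]

theorem qFrob_coe_CGroup (η : CGroup p k K) :
    qFrob p k K ((η : Kˣ) : K) = (((η⁻¹ : CGroup p k K) : Kˣ) : K) := by
  have h : ((η : Kˣ) : K) ^ (p ^ k) * ((η : Kˣ) : K) = 1 := by
    rw [← pow_succ, ← Units.val_pow_eq_pow_val, (mem_rootsOfUnity _ _).1 η.2, Units.val_one]
  rw [iterateFrobenius_def]
  change _ = (((η : Kˣ)⁻¹ : Kˣ) : K)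
  rw [Units.val_inv_eq_inv_val]
  exact eq_inv_of_mul_eq_one_left h

/-- The sequence obtained by applying the `q`-power map to all coefficients. -/
noncomputable def seqFrob (p k : ℕ) [Fact p.Prime] [CharP K p] (f : ℕ+ → K[X]) : ℕ+ → K[X] :=
  fun i => (f i).map (qFrob p k K)

theorem seqFrob_seqScale (η : CGroup p k K) {f : ℕ+ → K[X]} (hf : ∀ i, (f i).Monic) :
    seqFrob p k (seqScale η f) = seqScale η⁻¹ (seqFrob p k f) :=
  funext fun i => by
    rw [seqFrob, seqScale, map_scaleRoots _ _ _ (by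
      rw [(hf i).leadingCoeff, map_one]; exact one_ne_zero), qFrob_coe_CGroup]
    rfl

/-! ### Classes of `U(n, q)` and their sequences -/

variable {n : ℕ}

theorem HasSequence.scalarU_mul {g : unitaryGrp p k n K} {f : ℕ+ → K[X]}
    (hf : HasSequence g.1 f) (η : CGroup p k K) :
    HasSequence (scalarU p k n K η * g).1 (seqScale η f) :=
  HasSequence.scaleRoots hf (Units.ne_zero _) rfl

/-- The inverse of a unitary matrix is its conjugate transpose, hence has the sequence `f^[q]`. -/
theorem HasSequence.inv_unitary (hK : Nat.card K = (p ^ k) ^ 2) {g : unitaryGrp p k n K}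
    {f : ℕ+ → K[X]} (hf : HasSequence g.1 f) : HasSequence (g⁻¹).1 (seqFrob p k f) := by
  let σ : K ≃+* K := RingEquiv.ofBijective (qFrob p k K)
    (Function.Involutive.bijective (qFrob_qFrob hK))
  refine HasSequence.map_transpose hf σ ?_
  have h1 : adj p k g.1.val * g.1.val = 1 := g.2
  have h2 : g.1.val * (g⁻¹).1.val = 1 := g.1.mul_inv
  exact (left_inv_eq_right_inv h1 h2).symm

theorem isConj_iff_sequence_eq (hq : Odd (p ^ k)) (hK : Nat.card K = (p ^ k) ^ 2)
    {g h : unitaryGrp p k n K} {f F : ℕ+ → K[X]} (hg : HasSequence g.1 f)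
    (hh : HasSequence h.1 F) : IsConj g h ↔ f = F := by
  constructor
  · intro hc
    obtain ⟨x, rfl⟩ := isConj_iff.1 hc
    refine HasSequence.unique (hasSequence_congr (x := x.1) ?_ hg) hh
    change x.1 * g.1 = x.1 * g.1 * x.1⁻¹ * x.1
    rw [inv_mul_cancel_right]
  · rintro rfl
    obtain ⟨x, hx⟩ := hg.exists_conj hh
    exact isConj_of_conj_in_GL hq hK g h x hx

theorem isParameterizedBy_mk_iff (hq : Odd (p ^ k)) (hK : Nat.card K = (p ^ k) ^ 2)
    {g : unitaryGrp p k n K} {f F : ℕ+ → K[X]} (hg : HasSequence g.1 f) :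
    IsParameterizedBy (ConjClasses.mk g) F ↔ f = F := by
  constructor
  · intro h
    exact hg.unique (h g rfl)
  · rintro rfl h hh
    obtain ⟨F, hF⟩ := exists_hasSequence h.1
    rwa [← (isConj_iff_sequence_eq hq hK hF hg).1 (ConjClasses.mk_eq_mk_iff_isConj.1 hh)]

/-- `t g⁻¹` has the sequence `t.f^[q]`, so `g` is conjugate to `t g⁻¹` if and only if this is `f`. -/
theorem isZetaRealClass_mk_iff (hq : Odd (p ^ k)) (hK : Nat.card K = (p ^ k) ^ 2)
    (t : CGroup p k K) {g : unitaryGrp p k n K} {f : ℕ+ → K[X]} (hg : HasSequence g.1 f) :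
    IsZetaRealClass t (ConjClasses.mk g) ↔ f = seqScale t (seqFrob p k f) := by
  have key : ∀ h : unitaryGrp p k n K, HasSequence h.1 f →
      (IsConj h (scalarU p k n K t * h⁻¹) ↔ f = seqScale t (seqFrob p k f)) := fun h hh =>
    isConj_iff_sequence_eq hq hK hh ((hh.inv_unitary hK).scalarU_mul t)
  constructor
  · intro h
    exact (key g hg).1 (h g rfl)
  · intro h g' hg'
    exact (key g' ((isParameterizedBy_mk_iff hq hK hg).2 rfl g' hg')).2 h

theorem isRealClass_iff (c : ConjClasses (unitaryGrp p k n K)) :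
    IsRealClass c ↔ IsZetaRealClass 1 c := by
  have h : scalarU p k n K (1 : CGroup p k K) = 1 := by
    apply Subtype.ext
    apply Units.ext
    exact map_one (Matrix.scalar (Fin n))
  simp only [IsRealClass, IsZetaRealClass, h, one_mul]

theorem numReal_eq_numZetaReal_one (f : ℕ+ → K[X]) : numReal p k n f = numZetaReal p k n 1 f := by
  simp only [numReal, numZetaReal, isRealClass_iff]

theorem numZetaReal_eq_zero (hq : Odd (p ^ k)) (hK : Nat.card K = (p ^ k) ^ 2)
    {f : ℕ+ → K[X]} (hf : ∀ i, (f i).Monic) (hs : ∀ s : CGroup p k K, seqFrob p k f ≠ seqScale s f)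
    (t : CGroup p k K) : numZetaReal p k n t f = 0 := by
  rw [numZetaReal, Set.encard_eq_zero, Set.eq_empty_iff_forall_notMem]
  rintro c ⟨⟨F, ⟨η, hη⟩, hc⟩, ht⟩
  have hη' : F = seqScale η f := funext hη
  subst hη'
  obtain ⟨g, rfl⟩ := ConjClasses.mk_surjective c
  have h1 := (isZetaRealClass_mk_iff hq hK t (hc g rfl)).1 ht
  rw [seqFrob_seqScale η hf, ← seqScale_mul, seqScale_eq_iff, ← seqScale_mul, eq_comm,
    seqScale_eq_iff] at h1
  exact hs _ h1

/-- If `f^[q] = s.f`, the `t`-real classes in the orbit of `f` correspond to the square roots of `t s`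
in the quotient of `C_{q+1}` by the stabilizer of `f`: the class of `η.f` is `t`-real if and only if
`η.f = t.(η.f)^[q] = (t η⁻¹ s).f`. -/
theorem numZetaReal_eq_encard (hq : Odd (p ^ k)) (hK : Nat.card K = (p ^ k) ^ 2)
    {g : unitaryGrp p k n K} {f : ℕ+ → K[X]} (hg : HasSequence g.1 f) {s : CGroup p k K}
    (hs : seqFrob p k f = seqScale s f) (t : CGroup p k K) :
    numZetaReal p k n t f =
      {x : CGroup p k K ⧸ seqStabilizer p k f |
        x ^ 2 = ((t * s : CGroup p k K) : CGroup p k K ⧸ seqStabilizer p k f)}.encard := by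
  obtain ⟨ρ, hρ⟩ : ∃ ρ : CGroup p k K ⧸ seqStabilizer p k f → CGroup p k K,
      ∀ x, (ρ x : CGroup p k K ⧸ seqStabilizer p k f) = x :=
    ⟨Function.surjInv QuotientGroup.mk_surjective,
      Function.surjInv_eq QuotientGroup.mk_surjective⟩
  let Θ : CGroup p k K ⧸ seqStabilizer p k f → ConjClasses (unitaryGrp p k n K) := fun x =>
    ConjClasses.mk (scalarU p k n K (ρ x) * g)
  have hΘ : ∀ x : CGroup p k K ⧸ seqStabilizer p k f,
      HasSequence (scalarU p k n K (ρ x) * g).1 (seqScale (ρ x) f) := fun x =>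
    hg.scalarU_mul (ρ x)
  have hinj : Function.Injective Θ := by
    intro x y hxy
    have h1 := (isConj_iff_sequence_eq hq hK (hΘ x) (hΘ y)).1
      (ConjClasses.mk_eq_mk_iff_isConj.1 hxy)
    rwa [seqScale_eq_seqScale_iff, hρ, hρ] at h1
  have hreal : ∀ x, IsZetaRealClass t (Θ x) ↔
      x ^ 2 = ((t * s : CGroup p k K) : CGroup p k K ⧸ seqStabilizer p k f) := by
    intro x
    rw [isZetaRealClass_mk_iff hq hK t (hΘ x), seqFrob_seqScale _ hg.monic, hs, ← seqScale_mul,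
      ← seqScale_mul, seqScale_eq_seqScale_iff, hρ]
    have h2 : ((t * (ρ x)⁻¹ * s : CGroup p k K) : CGroup p k K ⧸ seqStabilizer p k f) =
        x⁻¹ * ((t * s : CGroup p k K) : CGroup p k K ⧸ seqStabilizer p k f) := by
      conv_rhs => rw [← hρ x]
      rw [← QuotientGroup.mk_inv, ← QuotientGroup.mk_mul]
      congr 1
      rw [mul_comm t, mul_assoc]
    rw [h2, eq_inv_mul_iff_mul_eq, sq]
  have himage : {c ∈ orbitClasses p k n f | IsZetaRealClass t c} =
      Θ '' {x | x ^ 2 = ((t * s : CGroup p k K) : CGroup p k K ⧸ seqStabilizer p k f)} := by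
    ext c
    constructor
    · rintro ⟨⟨F, ⟨η, hη⟩, hc⟩, ht⟩
      have hη' : F = seqScale η f := funext hη
      subst hη'
      obtain ⟨h, rfl⟩ := ConjClasses.mk_surjective c
      have hmk : Θ η = ConjClasses.mk h := by
        refine ConjClasses.mk_eq_mk_iff_isConj.2
          ((isConj_iff_sequence_eq hq hK (hΘ _) (hc h rfl)).2 ?_)
        rw [seqScale_eq_seqScale_iff, hρ]
      exact ⟨η, (hreal _).1 (hmk ▸ ht), hmk⟩
    · rintro ⟨x, hx, rfl⟩
      exact ⟨⟨seqScale (ρ x) f, ⟨ρ x, fun _ => rfl⟩,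
        (isParameterizedBy_mk_iff hq hK (hΘ x)).2 rfl⟩, (hreal x).2 hx⟩
  rw [numZetaReal, himage, hinj.encard_image]

/-- The polynomials of an element of `U(n, q)` are self-conjugate, since `f^[q]` and the reciprocal
of `f` are both the sequence of the inverse. -/
theorem HasSequence.seqFrob_eq_recip (hK : Nat.card K = (p ^ k) ^ 2) {g : unitaryGrp p k n K}
    {f : ℕ+ → K[X]} (hf : HasSequence g.1 f) (i : ℕ+) : (f i).map (qFrob p k K) = recip (f i) :=
  congrFun ((hf.inv_unitary hK).unique hf.inv) i

theorem HasSequence.mem_UPoly (hK : Nat.card K = (p ^ k) ^ 2) {g : unitaryGrp p k n K}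
    {f : ℕ+ → K[X]} (hf : HasSequence g.1 f) (i : ℕ+) : f i ∈ UPoly p k K := by
  refine ⟨hf.monic i, hf.coeff_zero_ne_zero i, ?_⟩
  rw [conjPoly_eq_recip, hf.seqFrob_eq_recip hK, recip_recip (hf.monic i) (hf.coeff_zero_ne_zero i)]

/-- If `f^[q] = s.f` and some `f_i` has odd degree, then `s` is a square: comparing constant terms,
`f_i(0)⁻¹ = f_i(0) * s ^ (deg f_i)`. -/
theorem isSquare_of_odd_natDegree (hK : Nat.card K = (p ^ k) ^ 2) {g : unitaryGrp p k n K}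
    {f : ℕ+ → K[X]} (hf : HasSequence g.1 f) {s : CGroup p k K}
    (hs : seqFrob p k f = seqScale s f) {i : ℕ+} (hi : Odd (f i).natDegree) : IsSquare s := by
  have h0 := hf.coeff_zero_ne_zero i
  have hrec : (f i).coeff 0 ^ p ^ k = ((f i).coeff 0)⁻¹ := by
    have := congrArg (fun F => F.coeff 0) (hf.seqFrob_eq_recip hK i)
    simpa only [coeff_map, coeff_zero_recip (hf.monic i), iterateFrobenius_def] using this
  have hscale : (f i).coeff 0 ^ p ^ k =
      (f i).coeff 0 * ((s : Kˣ) : K) ^ (f i).natDegree := by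
    have := congrArg (fun F => F.coeff 0) (congrFun hs i)
    simpa only [seqFrob, seqScale, coeff_map, coeff_scaleRoots, Nat.sub_zero,
      iterateFrobenius_def] using this
  let u : Kˣ := Units.mk0 _ h0
  have hu : u ∈ CGroup p k K := by
    rw [mem_rootsOfUnity]
    ext
    rw [Units.val_pow_eq_pow_val, pow_succ, Units.val_mk0, hrec, inv_mul_cancel₀ h0, Units.val_one]
  let a : CGroup p k K := ⟨u, hu⟩
  have ha : a⁻¹ = a * s ^ (f i).natDegree := by
    apply Subtype.ext
    apply Units.ext
    change ((u⁻¹ : Kˣ) : K) = ((u * (s : Kˣ) ^ (f i).natDegree : Kˣ) : K)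
    rw [Units.val_inv_eq_inv_val, Units.val_mul, Units.val_mk0, Units.val_pow_eq_pow_val, ← hscale,
      hrec]
  obtain ⟨j, hj⟩ := hi
  refine ⟨a⁻¹ * (s ^ j)⁻¹, ?_⟩
  rw [hj] at ha
  have h1 : a⁻¹ * a⁻¹ = s ^ (2 * j + 1) := by
    nth_rewrite 2 [ha]
    rw [inv_mul_cancel_left]
  calc s = s ^ (2 * j + 1) * ((s ^ j)⁻¹ * (s ^ j)⁻¹) := by
        rw [pow_succ, two_mul, pow_add]
        group
    _ = a⁻¹ * (s ^ j)⁻¹ * (a⁻¹ * (s ^ j)⁻¹) := by rw [← h1, mul_mul_mul_comm]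

end FieldOfSquareCard

/-! ### Counting the classes in an orbit -/

/-- The index of the stabilizer of the sequence of an element of `U(n, q)` is odd if and only if all
`f_i` are polynomials in `t ^ |q + 1|_2`. -/
theorem odd_card_quotient_seqStabilizer_iff {p k n : ℕ} [hp : Fact p.Prime] {K : Type*} [Field K]
    [CharP K p] (hK : Nat.card K = (p ^ k) ^ 2) {g : unitaryGrp p k n K} {f : ℕ+ → K[X]}
    (hf : HasSequence g.1 f) :
    Odd (Nat.card (CGroup p k K ⧸ seqStabilizer p k f)) ↔
      ∀ i, f i ∈ UPolyPow p k K (twoPart (p ^ k + 1)) := by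
  have hpos : 0 < twoPart (p ^ k + 1) := pow_pos two_pos _
  have hdvd : twoPart (p ^ k + 1) ∣ Nat.card (CGroup p k K) := by
    rw [natCard_CGroup hK]
    exact pow_padicValNat_dvd
  obtain ⟨z, hz⟩ := IsCyclic.exists_ofOrder_eq_natCard (α := CGroup p k K)
  obtain ⟨r, hr⟩ := hdvd
  have hcard : 0 < Nat.card (CGroup p k K) := by
    rw [natCard_CGroup hK]
    exact Nat.succ_pos _
  have hr0 : r ≠ 0 := by
    rintro rfl
    omega
  have hω : orderOf (z ^ r) = twoPart (p ^ k + 1) := by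
    rw [orderOf_pow_of_dvd hr0 (by rw [hz, hr]; exact dvd_mul_left _ _), hz, hr,
      Nat.mul_div_cancel _ (Nat.pos_of_ne_zero hr0)]
  have hωK : orderOf (((z ^ r : CGroup p k K) : Kˣ) : K) = twoPart (p ^ k + 1) := by
    rw [orderOf_units, Subgroup.orderOf_coe, hω]
  rw [odd_card_quotient_iff _ (ω := z ^ r) (by rw [hω, natCard_CGroup hK]), mem_seqStabilizer,
    funext_iff]
  exact forall_congr' fun i => scaleRoots_eq_self_iff (hf.mem_UPoly hK i) hpos hωK

theorem lemma3p6 (p k n : ℕ) [Fact p.Prime] (hq : Odd (p ^ k))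
    (K : Type*) [Field K] [CharP K p] (hK : Nat.card K = (p ^ k) ^ 2)
    (ζ : CGroup p k K) (hζ : ¬ IsSquare ζ)
    (ν : n.Partition) (c : ConjClasses (unitaryGrp p k n K)) (f : ℕ+ → K[X])
    (hf : IsParameterizedBy c f) (hν : ∀ i : ℕ+, (f i).natDegree = ν.parts.count (i : ℕ)) :
    ((∃ i : ℕ+, Odd (ν.parts.count (i : ℕ))) →
      numZetaReal p k n ζ f = 0 ∧ (numReal p k n f = 0 ∨ numReal p k n f = 2)) ∧
    ((∀ i : ℕ+, Even (ν.parts.count (i : ℕ))) →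
      (∀ i : ℕ+, f i ∈ UPolyPow p k K (twoPart (p ^ k + 1))) →
      (numReal p k n f = 0 ∧ numZetaReal p k n ζ f = 0) ∨
      (numReal p k n f = 1 ∧ numZetaReal p k n ζ f = 1)) ∧
    ((∀ i : ℕ+, Even (ν.parts.count (i : ℕ))) →
      (∃ j : ℕ+, f j ∉ UPolyPow p k K (twoPart (p ^ k + 1))) →
      (numReal p k n f = 0 ∧ numZetaReal p k n ζ f = 0) ∨
      (numReal p k n f = 2 ∧ numZetaReal p k n ζ f = 0) ∨
      (numReal p k n f = 0 ∧ numZetaReal p k n ζ f = 2)) := by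
  obtain ⟨g, rfl⟩ := ConjClasses.mk_surjective c
  have hg : HasSequence g.1 f := hf g rfl
  rw [numReal_eq_numZetaReal_one]
  by_cases hs : ∃ s : CGroup p k K, seqFrob p k f = seqScale s f
  swap
  · have h0 := numZetaReal_eq_zero (n := n) hq hK hg.monic (not_exists.1 hs)
    exact ⟨fun _ => ⟨h0 ζ, Or.inl (h0 1)⟩, fun _ _ => Or.inl ⟨h0 1, h0 ζ⟩,
      fun _ _ => Or.inl ⟨h0 1, h0 ζ⟩⟩
  obtain ⟨s, hs⟩ := hs
  have hodd := odd_card_quotient_seqStabilizer_iff hK hg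
  have : Finite (CGroup p k K) := Nat.finite_of_card_ne_zero (by
    rw [natCard_CGroup hK]
    exact Nat.succ_ne_zero _)
  have hcount := numZetaReal_eq_encard hq hK hg hs
  refine ⟨?_, ?_, ?_⟩
  · rintro ⟨i, hi⟩
    have hi' : Odd (f i).natDegree := by rwa [hν]
    have heven : Even (Nat.card (CGroup p k K ⧸ seqStabilizer p k f)) := by
      rw [← Nat.not_odd_iff_even, hodd]
      intro hall
      -- A polynomial in `t ^ m` with `m` even has even degree, and `q + 1` is even.
      obtain ⟨h, -, hh⟩ := hall i
      rw [hh, natDegree_expand] at hi'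
      have h2 : 2 ∣ twoPart (p ^ k + 1) := dvd_pow_self 2
        (Nat.one_le_iff_ne_zero.1
          (one_le_padicValNat_of_dvd (Nat.succ_ne_zero _) hq.add_one.two_dvd))
      exact (Nat.not_even_iff_odd.2 hi') ((even_iff_two_dvd.2 h2).mul_left _)
    rcases encard_sq_eq_of_even_card _ heven hζ s with ⟨h1, h2⟩ | ⟨h1, -⟩
    · exact ⟨by rw [hcount, h2], Or.inr (by rw [hcount, h1])⟩
    · obtain ⟨r, rfl⟩ := isSquare_of_odd_natDegree hK hg hs hi'
      rw [Set.encard_eq_zero, Set.eq_empty_iff_forall_notMem] at h1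
      refine (h1 r ?_).elim
      rw [Set.mem_ofPred_eq, one_mul, sq]
      rfl
  · intro _ hall
    have h1 := hodd.2 hall
    exact Or.inr ⟨by rw [hcount, encard_sq_eq_of_odd_card h1],
      by rw [hcount, encard_sq_eq_of_odd_card h1]⟩
  · rintro _ ⟨j, hj⟩
    have heven : Even (Nat.card (CGroup p k K ⧸ seqStabilizer p k f)) := by
      rw [← Nat.not_odd_iff_even, hodd]
      exact fun hall => hj (hall j)
    rw [hcount, hcount]
    exact Or.inr (encard_sq_eq_of_even_card _ heven hζ s)
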